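/- Let $p\ge 2$, $K\ge 1$, let $\lambda=(\lambda_1,\dots,\lambda_K)$ satisfy $\lambda_j\ge 0$ and $\sum_j\lambda_j=1$, and let $\Theta=(\theta_{j_1\ldots j_p})_{1\le j_1,\dots,j_p\le K}$ be a symmetric tensor with entries in $[0,1]$. For $N\ge 1$ put $\mathcal B_j=\left(N\sum_{i<j}\lambda_i,\;N\sum_{i\le j}\lambda_i\right]\cap\{1,\dots,N\}$. The hypergraph stochastic block model $H_N\sim\mathcal H_{p,K,N}(\lambda,\Theta)$ is the random $p$-uniform hypergraph on $\{1,\dots,N\}$ in which the hyperedges are present independently, and $\{i_1<\dots<i_p\}$ with $(i_1,\dots,i_p)\in\mathcal B_{j_1}\times\cdots\times\mathcal B_{j_p}$ is present with probability $\theta_{j_1\ldots j_p}$. Let $A_{H_N}=(a_{i_1\ldots i_p})$ be its adjacency tensor (symmetric, and zero whenever two indices agree) and $J_N=N^{-(p-1)}A_{H_N}$. Given $H_N$, the Ising model with parameter $\beta\ge 0$ is the law on $\{-1,1\}^N$ $$\mathbb P_\beta(x)=\frac{e^{\beta\,\mathcal E_N(x)}}{2^N Z_N(\beta)},\quad \mathcal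 E_N(x)=\sum_{1\le i_1,\dots,i_p\le N}J_{i_1\ldots i_p}x_{i_1}\cdots x_{i_p},\quad Z_N(\beta)=\frac1{2^N}\sum_{x\in\{-1,1\}^N}e^{\beta\,\mathcal E_N(x)},$$ and $F_N(\beta)=\log Z_N(\beta)$. With $m_i(x)=\sum_{i_2,\dots,i_p}J_{i\,i_2\ldots i_p}x_{i_2}\cdots x_{i_p}$, the maximum pseudolikelihood (MPL) estimate is $$\hat\beta_N(x)=\inf\Big\{b\ge 0:\ \mathcal E_N(x)=\sum_{i=1}^N m_i(x)\tanh\big(p\,b\,m_i(x)\big)\Big\},\qquad \inf\emptyset=+\infty.$$ Let $I(t)=\frac12\{(1+t)\log(1+t)+(1-t)\log(1-t)\}$ (with $0\log 0=0$), $$\phi_\beta(t_1,\dots,t_K)=\beta\sum_{1\le j_1,\dots,j_p\le K}\theta_{j_1\ldots j_p}\prod_{\ell=1}^p\lambda_{j_\ell}t_{j_\ell}-\sum_{j=1}^K\lambda_jI(t_j),$$ $$\beta^*_{\mathrm{HSBM}}=\sup\Big\{\beta\ge 0:\ \sup_{t\in[0,1]^K}\phi_\beta(t)=0\Big\}\in[0,+\infty].$$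 Let $(H_N)_{N}$ be random hypergraphs on a common probability space with $H_N\sim\mathcal H_{p,K,N}(\lambda,\Theta)$ for each $N$ (and an arbitrary joint law). Then the following hold. 1. There are constants $M(\delta,\beta)\in(0,\infty)$ such that, for almost every realization of $(H_N)_N$, the MPL estimate is $\sqrt N$-consistent at every $\beta>\beta^*_{\mathrm{HSBM}}$: for every $\delta>0$, $\ \mathbb P_\beta\big(\sqrt N\,|\hat\beta_N(X)-\beta|\le M(\delta,\beta)\big)>1-\delta$ for all sufficiently large $N$. 2. For every $0\le\beta<\beta^*_{\mathrm{HSBM}}$, $\ \mathbb E F_N(\beta)=O(1)$ as $N\to\infty$, the expectation being over $H_N$. No sequence of estimators is consistent below the threshold, in the following sense: for almost every realization of $(H_N)_N$ and all $0\le\beta_1<\beta_2<\beta^*_{\mathrm{HSBM}}$, there are no functions $T_N:\{-1,1\}^N\to[-\infty,\infty]$ (which may depend on the realization) such that, for both $\beta=\beta_1$ and $\beta=\beta_2$, $\ \mathbb P_\beta(|T_N(X)-\beta|\le r)\to 1$ as $N\to\infty$ for every $r>0$. Likewise, for all $0\le\beta_1<\beta_2<\beta^*_{\mathrm{HSBM}}$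 there are no functions $T_N(H_N,X)$ such that, for both $\beta=\beta_1$ and $\beta=\beta_2$, $\ \mathbb E\big[\mathbb P_\beta(|T_N(H_N,X)-\beta|\le r)\big]\to 1$ for every $r>0$. -/

import Mathlib

open MeasureTheory ProbabilityTheory Filter Topology

noncomputable section

/-! ### The `p`-tensor Ising model -/

/-- A `p`-tensor of size `N`: the entry `J i` is `J_{i₁ … i_p}`. -/
abbrev Tensor (p N : ℕ) : Type := (Fin p → Fin N) → ℝ

/-- Spin configurations `{-1, 1}^N`. -/
abbrev Spins (N : ℕ) : Type := Fin N → ℤˣ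

/-- The spin of the vertex `k`, as a real number `±1`. -/
def spin {N : ℕ} (x : Spins N) (k : Fin N) : ℝ := ((x k : ℤ) : ℝ)

/-- `H_N(x) = ∑ J_{i₁ … i_p} x_{i₁} ⋯ x_{i_p}`, the sum over all `p`-tuples of vertices. -/
def hamiltonian {p N : ℕ} (J : Tensor p N) (x : Spins N) : ℝ :=
  ∑ i : Fin p → Fin N, J i * ∏ l : Fin p, spin x (i l)

/-- `Z_N(β) = 2^{-N} ∑_x exp (β H_N(x))`. -/
def partitionFn {p N : ℕ} (J : Tensor p N) (β : ℝ) : ℝ :=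
  (∑ x : Spins N, Real.exp (β * hamiltonian J x)) / 2 ^ N

/-- `F_N(β) = log Z_N(β)`. -/
def logPartitionFn {p N : ℕ} (J : Tensor p N) (β : ℝ) : ℝ := Real.log (partitionFn J β)

/-- The probability mass function `ℙ_β(x) = exp (β H_N(x)) / (2^N Z_N(β))`. -/
def isingMass {p N : ℕ} (J : Tensor p N) (β : ℝ) (x : Spins N) : ℝ :=
  Real.exp (β * hamiltonian J x) / (2 ^ N * partitionFn J β)

open Classical in
/-- The probability `ℙ_β(X ∈ S)` of an event under the Ising model. -/
def isingProb {p N : ℕ} (J : Tensor p N) (β : ℝ) (S : Set (Spins N)) : ℝ :=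
  ∑ x : Spins N with x ∈ S, isingMass J β x

/-- The local field `m_k(x) = ∑_{i₂, …, i_p} J_{k i₂ … i_p} x_{i₂} ⋯ x_{i_p}`: the sum is over the
tuples whose first entry is `k`, and the product omits the first entry. -/
def localField {p N : ℕ} (J : Tensor p N) (x : Spins N) (k : Fin N) : ℝ :=
  ∑ i : Fin p → Fin N with (∀ l : Fin p, l.val = 0 → i l = k),
    J i * ∏ l : Fin p with l.val ≠ 0, spin x (i l)

/-- The maximum pseudolikelihood estimate
`inf {b ≥ 0 : H_N(x) = ∑_k m_k(x) tanh (p b m_k(x))}`, where the infimum of the empty set is `+∞`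
(so the infimum is taken in the extended reals). -/
def mple {p N : ℕ} (J : Tensor p N) (x : Spins N) : EReal :=
  sInf ((fun b : ℝ => (b : EReal)) '' {b : ℝ | 0 ≤ b ∧
    hamiltonian J x = ∑ k : Fin N, localField J x k * Real.tanh (p * b * localField J x k)})

/-! ### Consistency of estimators

An estimate may be infinite; `|e - β| ≤ r` then fails. -/

/-- `e` is finite and `|e - β| ≤ r`. -/
def WithinDist (e : EReal) (β r : ℝ) : Prop := ∃ b : ℝ, e = (b : EReal) ∧ |b - β| ≤ r

/-- Consistency at `β` of the estimators `est N` in the Ising models with tensors `J N`: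
`ℙ_β(|est N - β| ≤ r) → 1` for every `r > 0`. -/
def IsConsistentAt {p : ℕ} (J : ∀ N, Tensor p N) (est : ∀ N, Spins N → EReal) (β : ℝ) : Prop :=
  ∀ r : ℝ, 0 < r →
    Tendsto (fun N => isingProb (J N) β {x | WithinDist (est N x) β r}) atTop (𝓝 1)

/-- `√N`-consistency at `β` with the constants `M δ`: for every `δ > 0`,
`ℙ_β(√N |est N - β| ≤ M δ) > 1 - δ` for all large `N`. -/
def IsSqrtConsistentAt {p : ℕ} (J : ∀ N, Tensor p N) (est : ∀ N, Spins N → EReal) (β : ℝ)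
    (M : ℝ → ℝ) : Prop :=
  ∀ δ : ℝ, 0 < δ → 0 < M δ ∧ ∀ᶠ N : ℕ in atTop,
    1 - δ < isingProb (J N) β {x | WithinDist (est N x) β (M δ / √(N : ℝ))}

/-! ### The hypergraph stochastic block model -/

/-- The possible hyperedges: `p`-element sets of vertices. -/
abbrev HyperEdge (p N : ℕ) : Type := {e : Finset (Fin N) // e.card = p}

/-- A `p`-uniform hypergraph on the `N` vertices, given by the indicator of its hyperedges. -/
abbrev UniformHypergraph (p N : ℕ) : Type := HyperEdge p N → Bool

open Classical in
/-- The adjacency tensor: `a_{i₁ … i_p} = 1` if `i₁, …, i_p` are the `p` distinct vertices of a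
hyperedge of `G`, and `0` otherwise. -/
def adjTensor {p N : ℕ} (G : UniformHypergraph p N) : Tensor p N := fun i =>
  if ∃ e : HyperEdge p N, G e = true ∧ Finset.univ.image i = e.1 then 1 else 0

/-- The interaction tensor `J_N = A_G / N^{p-1}`. -/
def hsbmTensor {p N : ℕ} (G : UniformHypergraph p N) : Tensor p N := fun i =>
  adjTensor G i / (N : ℝ) ^ (p - 1)

/-- The block `B_j = (N ∑_{i<j} λ_i, N ∑_{i≤j} λ_i] ∩ {1, …, N}`; the element `v` of `Fin N` is the
vertex with number `v + 1`. -/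
def block {K : ℕ} (lam : Fin K → ℝ) (N : ℕ) (j : Fin K) : Set (Fin N) :=
  {v | N * ∑ i ∈ Finset.Iio j, lam i < (v.val : ℝ) + 1 ∧
    (v.val : ℝ) + 1 ≤ N * ∑ i ∈ Finset.Iic j, lam i}

open Classical in
/-- The probability of the hyperedge `{i₁ < ⋯ < i_p}`: it is `θ_{j₁ … j_p}` for the labels with
`(i₁, …, i_p) ∈ B_{j₁} × ⋯ × B_{j_p}`. These exist and are unique, since the blocks partition the
vertices whenever `λ` is a proportion vector. -/
def edgeProb {p K : ℕ} (lam : Fin K → ℝ) (Θ : (Fin p → Fin K) → unitInterval) (N : ℕ)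
    (e : HyperEdge p N) : unitInterval :=
  if h : ∃ j : Fin p → Fin K, ∀ l, e.1.orderEmbOfFin e.2 l ∈ block lam N (j l)
  then Θ h.choose else 0

/-- The law of the hypergraph stochastic block model on `N` vertices: the hyperedges are present
independently, with the probabilities `edgeProb`. -/
def hsbmLaw {p K : ℕ} (lam : Fin K → ℝ) (Θ : (Fin p → Fin K) → unitInterval) (N : ℕ) :
    Measure (UniformHypergraph p N) :=
  Measure.pi fun e => bernoulliMeasure true false (edgeProb lam Θ N e)

/-- Consistency at `β` under the joint law of the hypergraph and the spins, for estimators that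
are functions of both. -/
def IsJointlyConsistentAt {p K : ℕ} (lam : Fin K → ℝ) (Θ : (Fin p → Fin K) → unitInterval)
    (est : ∀ N, UniformHypergraph p N → Spins N → EReal) (β : ℝ) : Prop :=
  ∀ r : ℝ, 0 < r →
    Tendsto (fun N => ∫ G, isingProb (hsbmTensor G) β {x | WithinDist (est N G x) β r}
      ∂(hsbmLaw lam Θ N)) atTop (𝓝 1)

/-! ### The threshold -/

/-- `I(t) = ((1 + t) log (1 + t) + (1 - t) log (1 - t)) / 2`. -/
def binEntropyI (t : ℝ) : ℝ :=
  ((1 + t) * Real.log (1 + t) + (1 - t) * Real.log (1 - t)) / 2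

/-- `φ_β(t) = β ∑ θ_{j₁ … j_p} ∏_l λ_{j_l} t_{j_l} - ∑_j λ_j I(t_j)`. -/
def meanFieldFn {p K : ℕ} (lam : Fin K → ℝ) (Θ : (Fin p → Fin K) → unitInterval) (β : ℝ)
    (t : Fin K → ℝ) : ℝ :=
  β * (∑ j : Fin p → Fin K, (Θ j : ℝ) * ∏ l : Fin p, lam (j l) * t (j l)) -
    ∑ j : Fin K, lam j * binEntropyI (t j)

/-- `β*_HSBM = sup {β ≥ 0 : sup_{t ∈ [0,1]^K} φ_β(t) = 0}`, possibly `+∞`. -/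
def hsbmThreshold {p K : ℕ} (lam : Fin K → ℝ) (Θ : (Fin p → Fin K) → unitInterval) : EReal :=
  sSup ((fun β : ℝ => (β : EReal)) '' {β : ℝ | 0 ≤ β ∧
    IsLUB (meanFieldFn lam Θ β '' Set.Icc (0 : Fin K → ℝ) 1) 0})

end

/-! ### Sums over spin configurations -/

/-! The growth of `F_N` decides everything: it is linear in `N` above the threshold, and below it `E
Z_N` stays bounded.

Above the threshold some `t ∈ [0,1)^K` has `φ_β(t) > 0` (`exists_meanFieldFn_pos`). Testing the
Gibbs variational principle (`le_logPartitionFn`) on the product measure with mean `t_j` on block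
`j` gives `F_N ≥ cN`, provided the edge counts between blocks are not too small. They almost surely
are not, by a Chernoff bound and Borel–Cantelli (`ae_eventually_sum_adjTensor`), whatever the joint
law of the graphs. Linear growth of `F_N` forces `H(x) ≥ εN` with high probability, so `∑ m_k² ≥
ε²N` by Cauchy–Schwarz, and the pseudolikelihood function has slope of order `N` near `β`
(`le_plFn_sub`). Its score at `β` has second moment `O(N)`, since each summand is centered given the
other spins and the local fields depend weakly on each spin (`sum_exp_mul_score_sq_le`). The root
thus lies within `O(N^{-1/2})` of `β`.

Below the threshold choose `β' > β` with `φ_{β'} ≤ 0`. Averaging `Z_N` over the graph first replaces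
each edge indicator by its mean, up to a bounded factor (`integral_exp_adjTensor_le`). The averaged
energy depends only on the block magnetizations and is at most `β/β'` times their entropy, plus
`O(1)` (`mul_sum_injective_le`). Since `β/β' < 1`, the exponential moment of that entropy under fair
coins is bounded (`sum_exp_entropy_signMean_le`). Hence `E Z_N = O(1)`, which bounds `E F_N`.

A bound on `Z_N(β₂)` makes the laws at `β₁ < β₂` inseparable: an event of small probability at `β₂`
cannot have probability near one at `β₁` (`isingProb_le`). Fatou's lemma gives such a bound along a
random subsequence for almost every realization; Markov's inequality gives it with high probability
under the joint law. -/

lemma sum_intUnits (f : ℤˣ → ℝ) : ∑ u, f u = f 1 + f (-1) := by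
  rw [show (Finset.univ : Finset ℤˣ) = {1, -1} from rfl]
  rw [Finset.sum_pair (by decide)]

lemma spin_eq {N : ℕ} (x : Spins N) (k : Fin N) : spin x k = 1 ∨ spin x k = -1 := by
  rcases Int.units_eq_one_or (x k) with h | h <;> simp [spin, h]

lemma abs_spin {N : ℕ} (x : Spins N) (k : Fin N) : |spin x k| = 1 := by
  rcases spin_eq x k with h | h <;> simp [h]

lemma spin_mul_self {N : ℕ} (x : Spins N) (k : Fin N) : spin x k * spin x k = 1 := by
  rcases spin_eq x k with h | h <;> simp [h]

lemma abs_prod_spin {N : ℕ} {α : Type*} (x : Spins N) (s : Finset α) (i : α → Fin N) :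
    |∏ l ∈ s, spin x (i l)| = 1 := by
  rw [Finset.abs_prod]; simp [abs_spin]

/-- The product measure on signs with means `t k`. -/
noncomputable def tilt {ι : Type*} [Fintype ι] (t : ι → ℝ) (x : ι → ℤˣ) : ℝ :=
  ∏ k, (1 + t k * ((x k : ℤ) : ℝ)) / 2

lemma sum_tilt_mul {ι : Type*} [Fintype ι] [DecidableEq ι] (t : ι → ℝ) (h : ι → ℤˣ → ℝ) :
    ∑ x : ι → ℤˣ, tilt t x * ∏ k, h k (x k) =
      ∏ k, ((1 + t k) / 2 * h k 1 + (1 - t k) / 2 * h k (-1)) := by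
  have := Finset.prod_univ_sum (fun _ : ι => (Finset.univ : Finset ℤˣ))
    (fun k u => (1 + t k * ((u : ℤ) : ℝ)) / 2 * h k u)
  rw [Fintype.piFinset_univ] at this
  simp only [tilt, ← Finset.prod_mul_distrib]
  rw [← this]
  refine Finset.prod_congr rfl fun k _ => ?_
  rw [sum_intUnits]
  simp [sub_eq_add_neg]

lemma sum_tilt {ι : Type*} [Fintype ι] [DecidableEq ι] (t : ι → ℝ) :
    ∑ x : ι → ℤˣ, tilt t x = 1 := by
  have := sum_tilt_mul t (fun _ _ => 1)
  simp only [Finset.prod_const_one, mul_one] at this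
  rw [this]
  exact Finset.prod_eq_one fun k _ => by ring

lemma sum_tilt_mul_single {ι : Type*} [Fintype ι] [DecidableEq ι] (t : ι → ℝ) (k : ι)
    (h : ℤˣ → ℝ) :
    ∑ x : ι → ℤˣ, tilt t x * h (x k) = (1 + t k) / 2 * h 1 + (1 - t k) / 2 * h (-1) := by
  have := sum_tilt_mul t (fun k' u => if k' = k then h u else 1)
  have h2 : ∀ x : ι → ℤˣ, (∏ k', if k' = k then h (x k') else 1) = h (x k) := fun x => by
    rw [Finset.prod_ite_eq' Finset.univ k (fun k' => h (x k'))]; simp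
  simp only [h2] at this
  rw [this, Finset.prod_eq_single k]
  · simp
  · intro b _ hb; simp [hb]; ring
  · simp

/-- Independence turns the mean of a monomial into the monomial of the means. Injectivity is
essential, as a repeated spin squares to one. -/
lemma sum_tilt_mul_prod_spin {p N : ℕ} (t : Fin N → ℝ) (i : Fin p → Fin N)
    (hi : Function.Injective i) :
    ∑ x : Spins N, tilt t x * ∏ l, spin x (i l) = ∏ l, t (i l) := by
  classical
  have := sum_tilt_mul t (fun k u => if k ∈ Finset.univ.image i then ((u : ℤ) : ℝ) else 1)
  have h2 : ∀ g : Fin N → ℝ, (∏ k, if k ∈ Finset.univ.image i then g k else 1) =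
      ∏ l, g (i l) := fun g => by
    rw [Finset.prod_ite_mem, Finset.univ_inter, Finset.prod_image (fun a _ b _ h => hi h)]
  have h3 : ∀ x : Spins N, (∏ l, spin x (i l)) =
      ∏ k, if k ∈ Finset.univ.image i then ((x k : ℤ) : ℝ) else 1 := fun x =>
    (h2 (fun k => ((x k : ℤ) : ℝ))).symm
  simp only [h3]
  rw [this, ← h2]
  refine Finset.prod_congr rfl fun k _ => ?_
  split_ifs <;> simp <;> ring

lemma tilt_pos {ι : Type*} [Fintype ι] {t : ι → ℝ} (ht : ∀ k, |t k| < 1) (x : ι → ℤˣ) :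
    0 < tilt t x := by
  refine Finset.prod_pos fun k _ => ?_
  have := abs_lt.1 (ht k)
  rcases Int.units_eq_one_or (x k) with h | h <;> simp [h] <;> linarith

lemma log_tilt {ι : Type*} [Fintype ι] {t : ι → ℝ} (ht : ∀ k, |t k| < 1) (x : ι → ℤˣ) :
    Real.log (2 ^ Fintype.card ι * tilt t x) =
      ∑ k, Real.log (1 + t k * ((x k : ℤ) : ℝ)) := by
  have h : 2 ^ Fintype.card ι * tilt t x = ∏ k, (1 + t k * ((x k : ℤ) : ℝ)) := by
    rw [tilt, Finset.prod_div_distrib]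
    simp
    field_simp
  rw [h, Real.log_prod]
  intro k _
  have := abs_lt.1 (ht k)
  rcases Int.units_eq_one_or (x k) with h | h <;> simp [h] <;> linarith

/-! ### The partition function -/

lemma two_pow_mul_partitionFn {p N : ℕ} (J : Tensor p N) (β : ℝ) :
    2 ^ N * partitionFn J β = ∑ x : Spins N, Real.exp (β * hamiltonian J x) := by
  rw [partitionFn]; field_simp

lemma sum_exp_hamiltonian_pos {p N : ℕ} (J : Tensor p N) (β : ℝ) :
    0 < ∑ x : Spins N, Real.exp (β * hamiltonian J x) :=
  Finset.sum_pos (fun _ _ => Real.exp_pos _) Finset.univ_nonempty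

lemma partitionFn_pos {p N : ℕ} (J : Tensor p N) (β : ℝ) : 0 < partitionFn J β :=
  div_pos (sum_exp_hamiltonian_pos J β) (by positivity)

open Classical in
lemma isingProb_eq {p N : ℕ} (J : Tensor p N) (β : ℝ) (S : Set (Spins N)) :
    isingProb J β S = (∑ x : Spins N, if x ∈ S then Real.exp (β * hamiltonian J x) else 0) /
      ∑ x : Spins N, Real.exp (β * hamiltonian J x) := by
  simp only [isingProb, isingMass, two_pow_mul_partitionFn]
  rw [← Finset.sum_div, Finset.sum_filter]

lemma isingProb_mono {p N : ℕ} (J : Tensor p N) (β : ℝ) {S T : Set (Spins N)} (h : S ⊆ T) :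
    isingProb J β S ≤ isingProb J β T := by
  classical
  rw [isingProb_eq, isingProb_eq]
  refine div_le_div_of_nonneg_right (Finset.sum_le_sum fun x _ => ?_)
    (sum_exp_hamiltonian_pos J β).le
  by_cases hx : x ∈ S
  · simp [hx, h hx]
  · simp only [hx, if_false]; positivity

lemma isingProb_nonneg {p N : ℕ} (J : Tensor p N) (β : ℝ) (S : Set (Spins N)) :
    0 ≤ isingProb J β S := by
  classical
  rw [isingProb_eq]; positivity

lemma isingProb_compl {p N : ℕ} (J : Tensor p N) (β : ℝ) (S : Set (Spins N)) :
    isingProb J β Sᶜ = 1 - isingProb J β S := by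
  classical
  have h0 := sum_exp_hamiltonian_pos J β
  rw [isingProb_eq, isingProb_eq, eq_sub_iff_add_eq, ← add_div, ← Finset.sum_add_distrib,
    div_eq_one_iff_eq h0.ne']
  refine Finset.sum_congr rfl fun x _ => ?_
  by_cases hx : x ∈ S <;> simp [hx]

lemma isingProb_le_one {p N : ℕ} (J : Tensor p N) (β : ℝ) (S : Set (Spins N)) :
    isingProb J β S ≤ 1 := by
  have := isingProb_compl J β S
  have := isingProb_nonneg J β Sᶜ
  linarith

lemma isingProb_union_le {p N : ℕ} (J : Tensor p N) (β : ℝ) (S T : Set (Spins N)) :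
    isingProb J β (S ∪ T) ≤ isingProb J β S + isingProb J β T := by
  classical
  rw [isingProb_eq, isingProb_eq, isingProb_eq, ← add_div, ← Finset.sum_add_distrib]
  refine div_le_div_of_nonneg_right (Finset.sum_le_sum fun x _ => ?_)
    (sum_exp_hamiltonian_pos J β).le
  have := Real.exp_pos (β * hamiltonian J x)
  by_cases hx : x ∈ S <;> by_cases hy : x ∈ T <;> simp [hx, hy, this.le]

/-- Markov's inequality for the Ising model. -/
lemma isingProb_mul_le {p N : ℕ} (J : Tensor p N) (β : ℝ) (S : Set (Spins N)) (f : Spins N → ℝ)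
    (hf : ∀ x, 0 ≤ f x) (c : ℝ) (hS : ∀ x ∈ S, c ≤ f x) :
    c * isingProb J β S ≤ (∑ x : Spins N, Real.exp (β * hamiltonian J x) * f x) /
      ∑ x : Spins N, Real.exp (β * hamiltonian J x) := by
  classical
  rw [isingProb_eq, ← mul_div_assoc, Finset.mul_sum]
  refine div_le_div_of_nonneg_right (Finset.sum_le_sum fun x _ => ?_)
    (sum_exp_hamiltonian_pos J β).le
  have h := Real.exp_pos (β * hamiltonian J x)
  by_cases hx : x ∈ S
  · simp only [hx, if_true]
    rw [mul_comm]
    exact mul_le_mul_of_nonneg_left (hS x hx) h.le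
  · simp only [hx, if_false, mul_zero]
    exact mul_nonneg h.le (hf x)

/-! ### Tensors vanishing on repeated indices -/

lemma sum_tilt_mul_hamiltonian {p N : ℕ} {J : Tensor p N}
    (hJ : ∀ i, ¬ Function.Injective i → J i = 0) (t : Fin N → ℝ) :
    ∑ x : Spins N, tilt t x * hamiltonian J x = ∑ i, J i * ∏ l, t (i l) := by
  simp only [hamiltonian, Finset.mul_sum]
  rw [Finset.sum_comm]
  refine Finset.sum_congr rfl fun i _ => ?_
  by_cases hi : Function.Injective i
  · rw [← sum_tilt_mul_prod_spin t i hi, Finset.mul_sum]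
    exact Finset.sum_congr rfl fun x _ => by ring
  · simp [hJ i hi]

lemma tilt_zero {N : ℕ} (x : Spins N) : tilt (fun _ => (0 : ℝ)) x = (1 / 2) ^ N := by
  simp [tilt]

lemma sum_hamiltonian_eq_zero {p N : ℕ} (hp : p ≠ 0) {J : Tensor p N}
    (hJ : ∀ i, ¬ Function.Injective i → J i = 0) : ∑ x : Spins N, hamiltonian J x = 0 := by
  have h := sum_tilt_mul_hamiltonian hJ (fun _ => 0)
  simp only [tilt_zero, ← Finset.mul_sum, Finset.prod_const, Finset.card_univ, Fintype.card_fin,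
    zero_pow hp, mul_zero, Finset.sum_const_zero] at h
  exact (mul_eq_zero.1 h).resolve_left (by positivity)

/-- The Gibbs variational lower bound on product measures. -/
lemma le_logPartitionFn {p N : ℕ} {J : Tensor p N}
    (hJ : ∀ i, ¬ Function.Injective i → J i = 0) (β : ℝ) {t : Fin N → ℝ}
    (ht : ∀ k, |t k| < 1) :
    β * ∑ i, J i * ∏ l, t (i l) - ∑ k, binEntropyI (t k) ≤ logPartitionFn J β := by
  have hent : ∑ x : Spins N, tilt t x * Real.log (2 ^ N * tilt t x) =
      ∑ k, binEntropyI (t k) := by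
    have h1 : ∀ x : Spins N, Real.log (2 ^ N * tilt t x) =
        ∑ k, Real.log (1 + t k * ((x k : ℤ) : ℝ)) := fun x => by
      simpa using log_tilt ht x
    simp only [h1, Finset.mul_sum]
    rw [Finset.sum_comm]
    refine Finset.sum_congr rfl fun k _ => ?_
    rw [sum_tilt_mul_single t k (fun u => Real.log (1 + t k * ((u : ℤ) : ℝ)))]
    simp [binEntropyI]
    rw [← sub_eq_add_neg]; ring
  -- Jensen under the product measure: reweighting by the density `2 ^ N * tilt t x` rewrites the
  -- partition function as a mean of exponentials.
  have hjensen := convexOn_exp.map_sum_le (t := (Finset.univ : Finset (Spins N)))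
    (w := tilt t)
    (p := fun x => β * hamiltonian J x - Real.log (2 ^ N * tilt t x))
    (fun x _ => (tilt_pos ht x).le) (sum_tilt t) (fun _ _ => Set.mem_univ _)
  have hL : ∑ x : Spins N, tilt t x • (β * hamiltonian J x - Real.log (2 ^ N * tilt t x)) =
      β * ∑ i, J i * ∏ l, t (i l) - ∑ k, binEntropyI (t k) := by
    rw [← sum_tilt_mul_hamiltonian hJ, ← hent, Finset.mul_sum, ← Finset.sum_sub_distrib]
    exact Finset.sum_congr rfl fun x _ => by rw [smul_eq_mul]; ring
  have hR : ∑ x : Spins N, tilt t x •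
      Real.exp (β * hamiltonian J x - Real.log (2 ^ N * tilt t x)) = partitionFn J β := by
    rw [partitionFn, Finset.sum_div]
    refine Finset.sum_congr rfl fun x _ => ?_
    have := tilt_pos ht x
    rw [Real.exp_sub, Real.exp_log (by positivity), smul_eq_mul]
    field_simp
  rw [hL, hR] at hjensen
  rwa [logPartitionFn, Real.le_log_iff_exp_le (partitionFn_pos J β)]

lemma logPartitionFn_nonneg {p N : ℕ} (hp : p ≠ 0) {J : Tensor p N}
    (hJ : ∀ i, ¬ Function.Injective i → J i = 0) (β : ℝ) : 0 ≤ logPartitionFn J β := by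
  have := le_logPartitionFn hJ β (t := fun _ => 0) (by simp)
  simpa [binEntropyI, zero_pow hp] using this

lemma one_le_partitionFn {p N : ℕ} (hp : p ≠ 0) {J : Tensor p N}
    (hJ : ∀ i, ¬ Function.Injective i → J i = 0) (β : ℝ) : 1 ≤ partitionFn J β := by
  have := logPartitionFn_nonneg hp hJ β
  by_contra h
  exact absurd (Real.log_neg (partitionFn_pos J β) (not_le.1 h)) (not_lt.2 this)

/-- A substitute for monotonicity in the parameter, enough to pass from a real parameter to a larger
rational one. -/
lemma partitionFn_le_one_add {p N : ℕ} (J : Tensor p N) {β₁ β₂ : ℝ} (h1 : 0 ≤ β₁)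
    (h12 : β₁ ≤ β₂) : partitionFn J β₁ ≤ 1 + partitionFn J β₂ := by
  have h : ∀ x : Spins N, Real.exp (β₁ * hamiltonian J x) ≤
      1 + Real.exp (β₂ * hamiltonian J x) := fun x => by
    rcases le_total 0 (hamiltonian J x) with hH | hH
    · have := Real.exp_le_exp.2 (mul_le_mul_of_nonneg_right h12 hH)
      linarith
    · have := Real.exp_le_one_iff.2 (mul_nonpos_of_nonneg_of_nonpos h1 hH)
      have := Real.exp_pos (β₂ * hamiltonian J x)
      linarith
  have h2 := Finset.sum_le_sum fun x (_ : x ∈ Finset.univ) => h x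
  rw [Finset.sum_add_distrib, ← two_pow_mul_partitionFn, ← two_pow_mul_partitionFn] at h2
  simp at h2
  have h3 : (0 : ℝ) < 2 ^ N := by positivity
  nlinarith

/-- Comparison of the Ising models at two parameters. -/
lemma isingProb_le {p N : ℕ} (hp : p ≠ 0) {J : Tensor p N}
    (hJ : ∀ i, ¬ Function.Injective i → J i = 0) {β₁ β₂ M : ℝ} (h1 : 0 ≤ β₁) (h12 : β₁ < β₂)
    (hM : 0 < M) (S : Set (Spins N)) :
    isingProb J β₁ S ≤ partitionFn J β₂ *
      (Real.exp ((β₂ - β₁) * M) * isingProb J β₂ S + 1 / (β₂ * M)) := by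
  classical
  have h2 : 0 < β₂ := h1.trans_lt h12
  -- Where `H ≥ -M` the two weights are comparable. The last bracket is nonnegative everywhere
  -- because `exp u ≥ u`, and at least one where `H < -M`. Its linear term disappears on summation,
  -- since the Hamiltonian has mean zero under uniform spins.
  have key : ∀ x : Spins N, (if x ∈ S then Real.exp (β₁ * hamiltonian J x) else 0) ≤
      Real.exp ((β₂ - β₁) * M) * (if x ∈ S then Real.exp (β₂ * hamiltonian J x) else 0) +
        (Real.exp (β₂ * hamiltonian J x) / (β₂ * M) - hamiltonian J x / M) := fun x => by
    set H := hamiltonian J x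
    have hb : 0 ≤ Real.exp (β₂ * H) / (β₂ * M) - H / M := by
      have := Real.add_one_le_exp (β₂ * H)
      rw [sub_nonneg, div_le_div_iff₀ hM (by positivity)]
      nlinarith
    have hc : 0 ≤ Real.exp (β₂ * H) / (β₂ * M) := by positivity
    by_cases hx : x ∈ S
    · simp only [hx, if_true]
      by_cases hH : -M ≤ H
      · have : Real.exp (β₁ * H) ≤ Real.exp ((β₂ - β₁) * M) * Real.exp (β₂ * H) := by
          rw [← Real.exp_add, Real.exp_le_exp]; nlinarith
        linarith
      · have e1 : Real.exp (β₁ * H) ≤ 1 := Real.exp_le_one_iff.2 (by nlinarith)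
        have e2 : 1 ≤ -(H / M) := by
          rw [← neg_div, le_div_iff₀ hM]; linarith
        have e3 : 0 ≤ Real.exp ((β₂ - β₁) * M) * Real.exp (β₂ * H) := by positivity
        linarith
    · simpa only [hx, if_false, mul_zero, zero_add] using hb
  have hsum := Finset.sum_le_sum fun x (_ : x ∈ Finset.univ) => key x
  rw [Finset.sum_add_distrib, Finset.sum_sub_distrib, ← Finset.mul_sum, ← Finset.sum_div,
    ← Finset.sum_div, sum_hamiltonian_eq_zero hp hJ, zero_div, sub_zero] at hsum
  have hZ2 := two_pow_mul_partitionFn J β₂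
  have hZ1 := two_pow_mul_partitionFn J β₁
  have hZ1' := one_le_partitionFn hp hJ β₁
  have hpos2 := sum_exp_hamiltonian_pos J β₂
  have h2N : (0 : ℝ) < 2 ^ N := by positivity
  rw [isingProb_eq, isingProb_eq]
  have hge : (2 : ℝ) ^ N ≤ ∑ x : Spins N, Real.exp (β₁ * hamiltonian J x) := by
    rw [← hZ1]; nlinarith
  have hnn : 0 ≤ ∑ x : Spins N, (if x ∈ S then Real.exp (β₁ * hamiltonian J x) else 0) := by
    positivity
  refine (div_le_div_of_nonneg_left hnn h2N hge).trans ?_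
  rw [div_le_iff₀ h2N]
  refine hsum.trans (le_of_eq ?_)
  rw [← hZ2]
  have := partitionFn_pos J β₂
  field_simp

/-! ### The hyperbolic tangent -/

lemma Real.hasDerivAt_tanh' (x : ℝ) : HasDerivAt Real.tanh (1 / Real.cosh x ^ 2) x := by
  have h := (Real.hasDerivAt_sinh x).div (Real.hasDerivAt_cosh x) (Real.cosh_pos x).ne'
  have h1 : (Real.sinh / Real.cosh : ℝ → ℝ) = Real.tanh := by
    ext y; rw [Pi.div_apply, Real.tanh_eq_sinh_div_cosh]
  rw [h1] at h
  refine h.congr_deriv ?_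
  rw [← sq, ← sq, Real.cosh_sq_sub_sinh_sq]

lemma Real.continuous_tanh' : Continuous Real.tanh :=
  continuous_iff_continuousAt.2 fun x => (Real.hasDerivAt_tanh' x).continuousAt

lemma Real.tanh_sub_tanh (u v : ℝ) :
    Real.tanh v - Real.tanh u = Real.sinh (v - u) / (Real.cosh v * Real.cosh u) := by
  have := (Real.cosh_pos v).ne'
  have := (Real.cosh_pos u).ne'
  rw [Real.tanh_eq_sinh_div_cosh, Real.tanh_eq_sinh_div_cosh, Real.sinh_sub]
  field_simp

/-- Both `tanh` and `x - tanh x` are monotone. -/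
lemma Real.abs_tanh_sub_tanh_le (u v : ℝ) : |Real.tanh u - Real.tanh v| ≤ |u - v| := by
  have hmono : Monotone fun x : ℝ => x - Real.tanh x := by
    refine monotone_of_hasDerivAt_nonneg (f' := fun x => 1 - 1 / Real.cosh x ^ 2)
      (fun x => (hasDerivAt_id x).sub (Real.hasDerivAt_tanh' x)) fun x => ?_
    have h := Real.one_le_cosh x
    have : 1 / Real.cosh x ^ 2 ≤ 1 := by
      rw [div_le_one (by positivity)]; nlinarith
    simpa using this
  have hm2 : ∀ {u v : ℝ}, u ≤ v → Real.tanh u ≤ Real.tanh v := fun {u v} h => by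
    have := Real.tanh_sub_tanh u v
    have h2 : 0 ≤ Real.sinh (v - u) := Real.sinh_nonneg_iff.2 (by linarith)
    have : 0 ≤ Real.tanh v - Real.tanh u := by
      rw [this]
      exact div_nonneg h2 (mul_pos (Real.cosh_pos _) (Real.cosh_pos _)).le
    linarith
  rcases le_total u v with h | h
  · rw [abs_sub_comm, abs_sub_comm u, abs_of_nonneg (sub_nonneg.2 h),
      abs_of_nonneg (sub_nonneg.2 (hm2 h))]
    have := hmono h
    simp only at this
    linarith
  · rw [abs_of_nonneg (sub_nonneg.2 h), abs_of_nonneg (sub_nonneg.2 (hm2 h))]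
    have := hmono h
    simp only at this
    linarith

lemma Real.le_tanh_sub_tanh {u v L : ℝ} (huv : u ≤ v) (hu : |u| ≤ L) (hv : |v| ≤ L) :
    (v - u) / Real.cosh L ^ 2 ≤ Real.tanh v - Real.tanh u := by
  rw [Real.tanh_sub_tanh]
  have hL : |L| = L := abs_of_nonneg ((abs_nonneg u).trans hu)
  have h1 : Real.cosh v ≤ Real.cosh L := Real.cosh_le_cosh.2 (by rwa [hL])
  have h2 : Real.cosh u ≤ Real.cosh L := Real.cosh_le_cosh.2 (by rwa [hL])
  have := Real.cosh_pos u
  have := Real.cosh_pos v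
  have h3 : v - u ≤ Real.sinh (v - u) := Real.self_le_sinh_iff.2 (by linarith)
  have h4 : Real.cosh v * Real.cosh u ≤ Real.cosh L ^ 2 := by nlinarith
  refine div_le_div₀ (by linarith) h3 (by positivity) h4

/-- A lower bound on the slope of `b ↦ m tanh (c b m)`. -/
lemma le_mul_tanh_sub {c m b₁ b₂ B : ℝ} (hc : 0 ≤ c) (hm : |m| ≤ 1) (h0 : 0 ≤ b₁) (h12 : b₁ ≤ b₂)
    (hB : b₂ ≤ B) :
    c / Real.cosh (c * B) ^ 2 * m ^ 2 * (b₂ - b₁) ≤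
      m * Real.tanh (c * b₂ * m) - m * Real.tanh (c * b₁ * m) := by
  have aux : ∀ m : ℝ, 0 ≤ m → m ≤ 1 → c / Real.cosh (c * B) ^ 2 * m ^ 2 * (b₂ - b₁) ≤
      m * Real.tanh (c * b₂ * m) - m * Real.tanh (c * b₁ * m) := fun m hm0 hm1 => by
    have bd : ∀ b, 0 ≤ b → b ≤ B → |c * b * m| ≤ c * B := fun b hb hbB => by
      rw [abs_of_nonneg (by positivity)]
      have : c * b ≤ c * B := mul_le_mul_of_nonneg_left hbB hc
      have : 0 ≤ c * b := by positivity
      nlinarith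
    have h := Real.le_tanh_sub_tanh (u := c * b₁ * m) (v := c * b₂ * m) (L := c * B)
      (by gcongr) (bd b₁ h0 (h12.trans hB)) (bd b₂ (h0.trans h12) hB)
    have h2 := mul_le_mul_of_nonneg_left h hm0
    rw [mul_sub] at h2
    refine le_trans (le_of_eq ?_) h2
    ring
  -- Both sides are even in `m`.
  rcases le_total 0 m with h | h
  · exact aux m h (le_of_abs_le hm)
  · have := aux (-m) (by linarith) (by linarith [neg_le_of_abs_le hm])
    simpa [Real.tanh_neg] using this

/-- A sign whose two weights have ratio `exp (2a)` has mean `tanh a`; this identity is the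
cancellation behind the centering of the score. -/
lemma exp_two_mul_mul_sub_tanh {s : ℝ} (hs : s = 1 ∨ s = -1) (a : ℝ) :
    Real.exp (2 * a * s) * (s - Real.tanh a) = s + Real.tanh a := by
  have h1 : Real.exp (2 * a) = Real.exp a * Real.exp a := by rw [← Real.exp_add]; ring_nf
  have h2 : Real.exp (-(2 * a)) = Real.exp (-a) * Real.exp (-a) := by
    rw [← Real.exp_add]; ring_nf
  have h3 : Real.exp a * Real.exp (-a) = 1 := by rw [← Real.exp_add]; simp
  have h4 := Real.exp_pos a
  have h5 := Real.exp_pos (-a)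
  rw [Real.tanh_eq]
  rcases hs with rfl | rfl
  · rw [mul_one, h1]; field_simp
    linear_combination (2 * Real.exp a) * h3
  · rw [mul_neg_one, h2]; field_simp
    linear_combination (-2 * Real.exp (-a)) * h3

/-! ### Index tuples -/

lemma card_le_of_determined {p N : ℕ} (s : Finset (Fin p → Fin N)) (a : Fin p)
    (h : ∀ i ∈ s, ∀ i' ∈ s, (∀ l, l ≠ a → i l = i' l) → i a = i' a) : s.card ≤ N ^ (p - 1) := by
  classical
  have hinj : Set.InjOn (fun (i : Fin p → Fin N) (l : {l // l ≠ a}) => i l) s := by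
    intro i hi i' hi' hii
    have hne : ∀ l, l ≠ a → i l = i' l := fun l hl => congrFun hii ⟨l, hl⟩
    ext l
    by_cases hl : l = a
    · rw [hl, h i hi i' hi' hne]
    · rw [hne l hl]
  have := Finset.card_le_card_of_injOn (t := Finset.univ) _ (fun _ _ => Finset.mem_coe.2 (Finset.mem_univ _)) hinj
  simpa [Fintype.card_subtype_compl] using this

lemma card_apply_eq_le {p N : ℕ} (a : Fin p) (k : Fin N) :
    (Finset.univ.filter fun i : Fin p → Fin N => i a = k).card ≤ N ^ (p - 1) := by
  refine card_le_of_determined _ a fun i hi i' hi' _ => ?_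
  simp only [Finset.mem_filter] at hi hi'
  rw [hi.2, hi'.2]

lemma card_not_injective_le (p N : ℕ) :
    (Finset.univ.filter fun i : Fin p → Fin N => ¬ Function.Injective i).card ≤
      p ^ 2 * N ^ (p - 1) := by
  classical
  have hsub : (Finset.univ.filter fun i : Fin p → Fin N => ¬ Function.Injective i) ⊆
      (Finset.univ : Finset (Fin p × Fin p)).biUnion fun q =>
        Finset.univ.filter fun i : Fin p → Fin N => q.1 ≠ q.2 ∧ i q.1 = i q.2 := by
    intro i hi
    obtain ⟨a, b, hab, hne⟩ := Function.not_injective_iff.1 (Finset.mem_filter.1 hi).2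
    simp only [Finset.mem_biUnion, Finset.mem_filter, Finset.mem_univ, true_and]
    exact ⟨(a, b), hne, hab⟩
  refine (Finset.card_le_card hsub).trans (Finset.card_biUnion_le.trans ?_)
  refine (Finset.sum_le_card_nsmul _ _ (N ^ (p - 1)) fun q _ => ?_).trans ?_
  · refine card_le_of_determined _ q.1 fun i hi i' hi' hne => ?_
    simp only [Finset.mem_filter, Finset.mem_univ, true_and] at hi hi'
    rw [hi.2, hi'.2, hne q.2 hi.1.symm]
  · simp [sq]

/-! ### Mean-field tensors -/

/-- A symmetric tensor that vanishes on repeated indices, with entries at most `N ^ -(p - 1)`. -/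
structure IsMeanFieldTensor {p N : ℕ} (J : Tensor p N) : Prop where
  symm : ∀ (σ : Equiv.Perm (Fin p)) (i : Fin p → Fin N), J (i ∘ σ) = J i
  supp : ∀ i, ¬ Function.Injective i → J i = 0
  bound : ∀ i, |J i| ≤ 1 / (N : ℝ) ^ (p - 1)

/-- The configuration `x` with the spin at `j` flipped. -/
def flipSpin {N : ℕ} (j : Fin N) (x : Spins N) : Spins N := Function.update x j (-(x j))

lemma flipSpin_flipSpin {N : ℕ} (j : Fin N) (x : Spins N) : flipSpin j (flipSpin j x) = x := by
  simp [flipSpin]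

lemma spin_flipSpin_self {N : ℕ} (j : Fin N) (x : Spins N) :
    spin (flipSpin j x) j = - spin x j := by simp [flipSpin, spin]

lemma spin_flipSpin_of_ne {N : ℕ} {j k : Fin N} (h : k ≠ j) (x : Spins N) :
    spin (flipSpin j x) k = spin x k := by simp [flipSpin, spin, h]

lemma sum_comp_flipSpin {N : ℕ} (j : Fin N) (f : Spins N → ℝ) :
    ∑ x, f (flipSpin j x) = ∑ x, f x :=
  Equiv.sum_comp (Function.Involutive.toPerm (flipSpin j) (flipSpin_flipSpin j)) f

/-! ### Local fields, the pseudolikelihood score and its second moment -/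

section LocalField

variable {p N : ℕ} {J : Tensor p N}

lemma localField_eq (hp : 0 < p) (J : Tensor p N) (x : Spins N) (k : Fin N) :
    localField J x k = ∑ i : Fin p → Fin N, if i ⟨0, hp⟩ = k then
      J i * ∏ l ∈ Finset.univ.erase ⟨0, hp⟩, spin x (i l) else 0 := by
  rw [localField, Finset.sum_filter]
  refine Finset.sum_congr rfl fun i _ => ?_
  have h1 : (∀ l : Fin p, l.val = 0 → i l = k) ↔ i ⟨0, hp⟩ = k :=
    ⟨fun h => h _ rfl, fun h l hl => by rw [← h]; congr 1; exact Fin.ext hl⟩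
  have h2 : (Finset.univ.filter fun l : Fin p => l.val ≠ 0) = Finset.univ.erase ⟨0, hp⟩ := by
    ext l; simp [Fin.ext_iff]
  simp only [h1, h2]

lemma sum_localField_mul_spin (hp : 0 < p) (J : Tensor p N) (x : Spins N) :
    ∑ k, localField J x k * spin x k = hamiltonian J x := by
  simp only [localField_eq hp, Finset.sum_mul, hamiltonian]
  rw [Finset.sum_comm]
  refine Finset.sum_congr rfl fun i _ => ?_
  simp only [ite_mul, zero_mul]
  rw [Finset.sum_ite_eq]
  simp only [Finset.mem_univ, if_true]
  rw [mul_assoc, mul_comm _ (spin x _),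
    Finset.mul_prod_erase Finset.univ (fun l => spin x (i l)) (Finset.mem_univ _)]

lemma localField_flipSpin (hp : 0 < p) (hJ : ∀ i, ¬ Function.Injective i → J i = 0)
    (x : Spins N) (j : Fin N) : localField J (flipSpin j x) j = localField J x j := by
  simp only [localField_eq hp]
  refine Finset.sum_congr rfl fun i _ => ?_
  split_ifs with h
  · by_cases hi : Function.Injective i
    · congr 1
      refine Finset.prod_congr rfl fun l hl => spin_flipSpin_of_ne ?_ x
      rw [← h]
      exact fun h' => (Finset.mem_erase.1 hl).1 (hi h')
    · simp [hJ i hi]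
  · rfl

/-- An injective tuple meets `j` at most once, so the flip reverses exactly the monomials that
contain `j`. By symmetry of `J`, each of the `p` positions at which `j` can stand contributes the
same amount. -/
lemma hamiltonian_sub_flipSpin (hp : 0 < p) (hJ : IsMeanFieldTensor J) (x : Spins N) (j : Fin N) :
    hamiltonian J x - hamiltonian J (flipSpin j x) = 2 * p * spin x j * localField J x j := by
  have h1 : ∀ i : Fin p → Fin N, J i * ∏ l, spin x (i l) - J i * ∏ l, spin (flipSpin j x) (i l) =
      ∑ l, if i l = j then 2 * (J i * ∏ l', spin x (i l')) else 0 := fun i => by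
    by_cases hi : Function.Injective i
    · by_cases hj : ∃ l, i l = j
      · obtain ⟨l, rfl⟩ := hj
        have h2 : ∀ l', (i l' = i l) = (l' = l) := fun l' => propext hi.eq_iff
        simp only [h2, Finset.sum_ite_eq', Finset.mem_univ, if_true]
        have h3 : ∏ l', spin (flipSpin (i l) x) (i l') = - ∏ l', spin x (i l') := by
          rw [← Finset.mul_prod_erase Finset.univ _ (Finset.mem_univ l),
            ← Finset.mul_prod_erase Finset.univ (fun l' => spin x (i l')) (Finset.mem_univ l),
            spin_flipSpin_self, neg_mul]
          congr 2
          refine Finset.prod_congr rfl fun l' hl' => spin_flipSpin_of_ne ?_ x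
          exact fun h' => (Finset.mem_erase.1 hl').1 (hi h')
        rw [h3]; ring
      · push Not at hj
        simp only [hj, if_false, Finset.sum_const_zero]
        have : ∏ l, spin (flipSpin j x) (i l) = ∏ l, spin x (i l) :=
          Finset.prod_congr rfl fun l _ => spin_flipSpin_of_ne (hj l) x
        rw [this, sub_self]
    · simp [hJ.supp i hi]
  simp only [hamiltonian]
  rw [← Finset.sum_sub_distrib]
  simp only [h1]
  rw [Finset.sum_comm]
  have h4 : ∀ l : Fin p, (∑ i : Fin p → Fin N,
      if i l = j then 2 * (J i * ∏ l', spin x (i l')) else 0) =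
      2 * spin x j * localField J x j := fun l => by
    rw [localField_eq hp, Finset.mul_sum]
    rw [← Equiv.sum_comp (Equiv.arrowCongr (Equiv.swap l ⟨0, hp⟩) (Equiv.refl (Fin N)))]
    refine Finset.sum_congr rfl fun i _ => ?_
    have h5 : (Equiv.arrowCongr (Equiv.swap l ⟨0, hp⟩) (Equiv.refl (Fin N))) i =
        i ∘ (Equiv.swap l ⟨0, hp⟩) := by ext; simp [Equiv.arrowCongr]
    rw [h5, hJ.symm]
    simp only [Function.comp_apply, Equiv.swap_apply_left]
    rw [Equiv.prod_comp (Equiv.swap l ⟨0, hp⟩) (fun l' => spin x (i l')),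
      ← Finset.mul_prod_erase Finset.univ (fun l' => spin x (i l')) (Finset.mem_univ ⟨0, hp⟩)]
    split_ifs with h
    · rw [h]; ring
    · simp
  simp only [h4, Finset.sum_const, Finset.card_univ, Fintype.card_fin, nsmul_eq_mul]
  ring

lemma sum_abs_le_one (hp : 0 < p) (hJ : IsMeanFieldTensor J) (k : Fin N) :
    (∑ i : Fin p → Fin N, if i ⟨0, hp⟩ = k then |J i| else 0) ≤ 1 := by
  rw [← Finset.sum_filter]
  refine (Finset.sum_le_card_nsmul _ _ _ fun i _ => hJ.bound i).trans ?_
  rw [nsmul_eq_mul]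
  have h := card_apply_eq_le (⟨0, hp⟩ : Fin p) k
  have h2 : (0 : ℝ) < (N : ℝ) ^ (p - 1) := by
    have : 0 < N := k.pos
    positivity
  rw [mul_one_div, div_le_one h2]
  exact_mod_cast h

lemma abs_localField_le (hp : 0 < p) (hJ : IsMeanFieldTensor J) (x : Spins N) (k : Fin N) :
    |localField J x k| ≤ 1 := by
  rw [localField_eq hp]
  refine (Finset.abs_sum_le_sum_abs _ _).trans (le_trans (Finset.sum_le_sum fun i _ => ?_)
    (sum_abs_le_one hp hJ k))
  split_ifs
  · rw [abs_mul, abs_prod_spin, mul_one]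
  · simp

/-- A bound on the influence of the spin at `j` on the local field at `k`. -/
noncomputable def influence (hp : 0 < p) (J : Tensor p N) (k j : Fin N) : ℝ :=
  ∑ i : Fin p → Fin N, if i ⟨0, hp⟩ = k then |J i| * ∑ l, (if i l = j then 2 else 0) else 0

lemma influence_nonneg (hp : 0 < p) (J : Tensor p N) (k j : Fin N) : 0 ≤ influence hp J k j := by
  unfold influence
  positivity

/-- Each tuple starting at `k` is charged 2 for each of its `p` entries, and those tuples have total
weight at most one. -/
lemma sum_influence_le (hp : 0 < p) (hJ : IsMeanFieldTensor J) (k : Fin N) :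
    ∑ j, influence hp J k j ≤ 2 * p := by
  simp only [influence]
  rw [Finset.sum_comm]
  have h : ∀ i : Fin p → Fin N, (∑ j, if i ⟨0, hp⟩ = k then
      |J i| * ∑ l, (if i l = j then (2 : ℝ) else 0) else 0) =
      2 * p * (if i ⟨0, hp⟩ = k then |J i| else 0) := fun i => by
    split_ifs
    · rw [← Finset.mul_sum, Finset.sum_comm]
      simp; ring
    · simp
  simp only [h]
  rw [← Finset.mul_sum]
  have := sum_abs_le_one hp hJ k
  have : (0 : ℝ) ≤ 2 * p := by positivity
  nlinarith

lemma abs_localField_sub_flipSpin_le (hp : 0 < p) (J : Tensor p N) (x : Spins N) (k j : Fin N) :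
    |localField J x k - localField J (flipSpin j x) k| ≤ influence hp J k j := by
  rw [localField_eq hp, localField_eq hp, ← Finset.sum_sub_distrib]
  refine (Finset.abs_sum_le_sum_abs _ _).trans (Finset.sum_le_sum fun i _ => ?_)
  split_ifs
  · rw [← mul_sub, abs_mul]
    refine mul_le_mul_of_nonneg_left ?_ (abs_nonneg _)
    by_cases h : ∃ l, i l = j
    · obtain ⟨l, hl⟩ := h
      have h2 : (2 : ℝ) ≤ ∑ l, (if i l = j then 2 else 0) :=
        le_trans (by simp [hl])
          (Finset.single_le_sum (f := fun l => if i l = j then (2 : ℝ) else 0)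
            (fun l _ => by positivity) (Finset.mem_univ l))
      refine le_trans ((abs_sub _ _).trans (le_of_eq ?_)) h2
      rw [abs_prod_spin, abs_prod_spin]; norm_num
    · push Not at h
      have : ∏ l ∈ Finset.univ.erase ⟨0, hp⟩, spin (flipSpin j x) (i l) =
          ∏ l ∈ Finset.univ.erase ⟨0, hp⟩, spin x (i l) :=
        Finset.prod_congr rfl fun l _ => spin_flipSpin_of_ne (h l) x
      rw [this, sub_self, abs_zero]
      positivity
  · simp

/-- The contribution of the vertex `k` to the pseudolikelihood score. -/
noncomputable def score (J : Tensor p N) (β : ℝ) (k : Fin N) (x : Spins N) : ℝ :=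
  localField J x k * (spin x k - Real.tanh (p * β * localField J x k))

lemma abs_score_le (hp : 0 < p) (hJ : IsMeanFieldTensor J) (β : ℝ) (k : Fin N) (x : Spins N) :
    |score J β k x| ≤ 2 := by
  rw [score, abs_mul]
  have h1 := abs_localField_le hp hJ x k
  have h2 : |spin x k - Real.tanh (p * β * localField J x k)| ≤ 2 := by
    refine (abs_sub _ _).trans ?_
    rw [abs_spin]
    linarith [(Real.abs_tanh_lt_one (p * β * localField J x k)).le]
  nlinarith [abs_nonneg (localField J x k),
    abs_nonneg (spin x k - Real.tanh (p * β * localField J x k))]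

lemma abs_score_sub_flipSpin_le (hp : 0 < p) (hJ : IsMeanFieldTensor J) {β : ℝ} (hβ : 0 ≤ β)
    (k j : Fin N) (x : Spins N) :
    |score J β k x - score J β k (flipSpin j x)| ≤
      (2 + p * β) * influence hp J k j + if k = j then 4 else 0 := by
  have hI := influence_nonneg hp J k j
  split_ifs with h
  · refine (abs_sub _ _).trans ?_
    have h1 := abs_score_le hp hJ β k x
    have h2 := abs_score_le hp hJ β k (flipSpin j x)
    have : 0 ≤ (2 + p * β) * influence hp J k j := by positivity
    linarith
  · simp only [score]
    rw [spin_flipSpin_of_ne h]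
    have hd := abs_localField_sub_flipSpin_le hp J x k j
    have hm := abs_localField_le hp hJ (flipSpin j x) k
    set m := localField J x k
    set m' := localField J (flipSpin j x) k
    have e : m * (spin x k - Real.tanh (p * β * m)) - m' * (spin x k - Real.tanh (p * β * m')) =
        (m - m') * (spin x k - Real.tanh (p * β * m)) -
          m' * (Real.tanh (p * β * m) - Real.tanh (p * β * m')) := by ring
    rw [e]
    refine (abs_sub _ _).trans ?_
    rw [abs_mul, abs_mul]
    have h1 : |spin x k - Real.tanh (p * β * m)| ≤ 2 := by
      refine (abs_sub _ _).trans ?_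
      rw [abs_spin]
      linarith [(Real.abs_tanh_lt_one (p * β * m)).le]
    have h2 : |Real.tanh (p * β * m) - Real.tanh (p * β * m')| ≤ p * β * |m - m'| := by
      refine (Real.abs_tanh_sub_tanh_le _ _).trans (le_of_eq ?_)
      rw [← mul_sub, abs_mul, abs_of_nonneg (by positivity)]
    have h3 : |m - m'| * |spin x k - Real.tanh (p * β * m)| ≤ |m - m'| * 2 := by gcongr
    have h4 : |m'| * |Real.tanh (p * β * m) - Real.tanh (p * β * m')| ≤
        1 * (p * β * |m - m'|) := by gcongr
    have h5 : (2 + p * β) * |m - m'| ≤ (2 + p * β) * influence hp J k j := by gcongr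
    linarith

/-- The score at `j` is centered given the other spins. -/
lemma sum_exp_mul_score_eq_zero (hp : 0 < p) (hJ : IsMeanFieldTensor J) (β : ℝ) (j : Fin N)
    (g : Spins N → ℝ) (hg : ∀ x, g (flipSpin j x) = g x) :
    ∑ x : Spins N, Real.exp (β * hamiltonian J x) * (g x * score J β j x) = 0 := by
  set f : Spins N → ℝ := fun x => Real.exp (β * hamiltonian J x) * (g x * score J β j x)
  have h1 : ∀ x, f x + f (flipSpin j x) = 0 := fun x => by
    simp only [f, score, hg, localField_flipSpin hp hJ.supp, spin_flipSpin_self]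
    set m := localField J x j
    -- Pair each configuration with its flip at `j`: the local field at `j` is unchanged, and the
    -- ratio of weights is the one for which `tanh` is the conditional mean.
    have hH : β * hamiltonian J x =
        β * hamiltonian J (flipSpin j x) + 2 * (p * β * m) * spin x j := by
      have := hamiltonian_sub_flipSpin hp hJ x j
      linear_combination β * this
    rw [hH, Real.exp_add]
    have h2 := exp_two_mul_mul_sub_tanh (spin_eq x j) (p * β * m)
    linear_combination (Real.exp (β * hamiltonian J (flipSpin j x)) * g x * m) * h2
  have h2 := sum_comp_flipSpin j f
  have h3 : ∑ x, f x + ∑ x, f (flipSpin j x) = 0 := by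
    rw [← Finset.sum_add_distrib]
    exact Finset.sum_eq_zero fun x _ => h1 x
  linarith

/-- Expand the square. In the pair `(k, j)` only the dependence of the `k`-th score on the spin at
`j` survives, and the influences sum over `j` to a constant for each `k`. -/
lemma sum_exp_mul_score_sq_le (hp : 0 < p) (hJ : IsMeanFieldTensor J) {β : ℝ} (hβ : 0 ≤ β) :
    ∑ x : Spins N, Real.exp (β * hamiltonian J x) * (∑ k, score J β k x) ^ 2 ≤
      N * ((2 + p * β) * (2 * p) + 4) * ∑ x : Spins N, Real.exp (β * hamiltonian J x) := by
  set W : Spins N → ℝ := fun x => Real.exp (β * hamiltonian J x)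
  have hpair : ∀ k j, ∑ x, W x * (score J β k x * score J β j x) ≤
      ((2 + p * β) * influence hp J k j + if k = j then 4 else 0) * ∑ x, W x := fun k j => by
    -- The symmetrization over the spin at `j` is invariant under the flip, so its product with the
    -- score at `j` has mean zero and may be subtracted.
    set a : Spins N → ℝ := fun x => (score J β k x + score J β k (flipSpin j x)) / 2
    have ha : ∀ x, a (flipSpin j x) = a x := fun x => by
      simp only [a, flipSpin_flipSpin]; ring
    have h0 := sum_exp_mul_score_eq_zero hp hJ β j a ha
    have h1 : ∑ x, W x * (score J β k x * score J β j x) =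
        ∑ x, W x * ((score J β k x - a x) * score J β j x) := by
      rw [← sub_eq_zero, ← Finset.sum_sub_distrib, ← h0]
      exact Finset.sum_congr rfl fun x _ => by simp only [W]; ring
    rw [h1, Finset.mul_sum]
    refine Finset.sum_le_sum fun x _ => ?_
    rw [mul_comm]
    refine mul_le_mul_of_nonneg_right ?_ (Real.exp_pos _).le
    refine (le_abs_self _).trans ?_
    rw [abs_mul]
    have h2 := abs_score_le hp hJ β j x
    have h3 := abs_score_sub_flipSpin_le hp hJ hβ k j x
    have h4 : |score J β k x - a x| = |score J β k x - score J β k (flipSpin j x)| / 2 := by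
      rw [eq_div_iff two_ne_zero, ← abs_two (α := ℝ), ← abs_mul]
      congr 1
      simp only [a]; ring
    rw [h4]
    nlinarith [abs_nonneg (score J β k x - score J β k (flipSpin j x)), abs_nonneg (score J β j x)]
  have hexp : ∑ x, W x * (∑ k, score J β k x) ^ 2 =
      ∑ k, ∑ j, ∑ x, W x * (score J β k x * score J β j x) := by
    have h : ∀ x, W x * (∑ k, score J β k x) ^ 2 =
        ∑ k, ∑ j, W x * (score J β k x * score J β j x) := fun x => by
      rw [sq, Finset.sum_mul_sum, Finset.mul_sum]
      exact Finset.sum_congr rfl fun k _ => Finset.mul_sum _ _ _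
    simp only [h]
    rw [Finset.sum_comm]
    exact Finset.sum_congr rfl fun k _ => Finset.sum_comm
  rw [hexp]
  refine (Finset.sum_le_sum fun k _ => Finset.sum_le_sum fun j _ => hpair k j).trans ?_
  simp only [← Finset.sum_mul]
  refine mul_le_mul_of_nonneg_right ?_ (sum_exp_hamiltonian_pos J β).le
  have hk : ∀ k : Fin N, ∑ j, ((2 + p * β) * influence hp J k j + if k = j then 4 else 0) ≤
      (2 + p * β) * (2 * p) + 4 := fun k => by
    rw [Finset.sum_add_distrib, ← Finset.mul_sum]
    have h1 := sum_influence_le hp hJ k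
    have h2 : (∑ j, if k = j then (4 : ℝ) else 0) = 4 := by simp
    rw [h2]
    have : (0 : ℝ) ≤ 2 + p * β := by positivity
    gcongr
  refine (Finset.sum_le_sum fun k _ => hk k).trans (le_of_eq ?_)
  simp only [Finset.sum_const, Finset.card_univ, Fintype.card_fin, nsmul_eq_mul]

/-! ### The maximum pseudolikelihood estimate -/

/-- The right-hand side of the pseudolikelihood equation. -/
noncomputable def plFn (J : Tensor p N) (x : Spins N) (b : ℝ) : ℝ :=
  ∑ k, localField J x k * Real.tanh (p * b * localField J x k)

lemma continuous_plFn (J : Tensor p N) (x : Spins N) : Continuous (plFn J x) := by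
  unfold plFn
  refine continuous_finsetSum _ fun k _ => continuous_const.mul
    (Real.continuous_tanh'.comp ?_)
  fun_prop

lemma sum_score_eq (hp : 0 < p) (J : Tensor p N) (β : ℝ) (x : Spins N) :
    ∑ k, score J β k x = hamiltonian J x - plFn J x β := by
  rw [← sum_localField_mul_spin hp, plFn, ← Finset.sum_sub_distrib]
  exact Finset.sum_congr rfl fun k _ => by rw [score]; ring

/-- Cauchy–Schwarz applied to `H = ∑ m_k x_k` turns a large energy into a lower bound on `∑ m_k²`,
to which the slope is proportional. -/
lemma le_plFn_sub (hp : 0 < p) (hJ : IsMeanFieldTensor J) (x : Spins N) {ε b₁ b₂ B : ℝ}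
    (hε : 0 ≤ ε) (hH : ε * N ≤ hamiltonian J x) (h0 : 0 ≤ b₁) (h12 : b₁ ≤ b₂) (hB : b₂ ≤ B) :
    p / Real.cosh (p * B) ^ 2 * ε ^ 2 * N * (b₂ - b₁) ≤ plFn J x b₂ - plFn J x b₁ := by
  rcases Nat.eq_zero_or_pos N with hN | hN
  · subst hN; simp [plFn]
  have hN' : (0 : ℝ) < N := by exact_mod_cast hN
  have hsq : ε ^ 2 * N ≤ ∑ k, localField J x k ^ 2 := by
    have h1 : hamiltonian J x ^ 2 ≤ N * ∑ k, localField J x k ^ 2 := by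
      rw [← sum_localField_mul_spin hp]
      refine (Finset.sum_mul_sq_le_sq_mul_sq Finset.univ _ _).trans (le_of_eq ?_)
      have : ∀ k, spin x k ^ 2 = 1 := fun k => by rw [sq, spin_mul_self]
      simp [this, mul_comm]
    have h2 : (ε * N) ^ 2 ≤ hamiltonian J x ^ 2 := by gcongr
    have h3 : N * (ε ^ 2 * N) ≤ N * ∑ k, localField J x k ^ 2 := by
      refine le_trans (le_of_eq ?_) (h2.trans h1); ring
    exact le_of_mul_le_mul_left h3 hN'
  have hc : 0 ≤ p / Real.cosh (p * B) ^ 2 * (b₂ - b₁) := by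
    have : 0 ≤ b₂ - b₁ := by linarith
    positivity
  have h3 : p / Real.cosh (p * B) ^ 2 * (b₂ - b₁) * ∑ k, localField J x k ^ 2 ≤
      plFn J x b₂ - plFn J x b₁ := by
    rw [plFn, plFn, ← Finset.sum_sub_distrib, Finset.mul_sum]
    refine Finset.sum_le_sum fun k _ => ?_
    refine le_trans (le_of_eq ?_)
      (le_mul_tanh_sub (Nat.cast_nonneg p) (abs_localField_le hp hJ x k) h0 h12 hB)
    ring
  have h4 := mul_le_mul_of_nonneg_left hsq hc
  linarith

/-- The intermediate value theorem gives a root in `[β - r, β + r]`, and strict monotonicity on `[0,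
∞)` makes it the only element of the set whose infimum is the estimate. The condition `r ≤ β` keeps
the interval nonnegative; `r ≤ 1` lets the slope constant be taken at `β + 1`. -/
lemma withinDist_mple (hp : 0 < p) (hJ : IsMeanFieldTensor J) (hN : 0 < N) (x : Spins N)
    {ε β r : ℝ} (hε : 0 < ε) (hH : ε * N ≤ hamiltonian J x) (hr : 0 < r) (hr1 : r ≤ 1)
    (hrβ : r ≤ β)
    (hQ : |hamiltonian J x - plFn J x β| ≤ p / Real.cosh (p * (β + 1)) ^ 2 * ε ^ 2 * N * r) :
    WithinDist (mple J x) β r := by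
  have hQ' := abs_le.1 hQ
  have hu := le_plFn_sub hp hJ x hε.le hH (b₁ := β) (b₂ := β + r) (B := β + 1) (by linarith)
    (by linarith) (by linarith)
  have hl := le_plFn_sub hp hJ x hε.le hH (b₁ := β - r) (b₂ := β) (B := β + 1) (by linarith)
    (by linarith) (by linarith)
  rw [add_sub_cancel_left] at hu
  rw [sub_sub_cancel] at hl
  obtain ⟨b, hb, hbH⟩ := intermediate_value_Icc (show β - r ≤ β + r by linarith)
    (continuous_plFn J x).continuousOn
    (show hamiltonian J x ∈ Set.Icc _ _ from ⟨by linarith, by linarith⟩)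
  have hmono : StrictMonoOn (plFn J x) (Set.Ici 0) := by
    intro b₁ h1 b₂ _ h12
    have h := le_plFn_sub hp hJ x hε.le hH (b₁ := b₁) (b₂ := b₂) (B := b₂) h1 h12.le le_rfl
    have hpos : 0 < p / Real.cosh (p * b₂) ^ 2 * ε ^ 2 * N * (b₂ - b₁) := by
      have : 0 < b₂ - b₁ := by linarith
      have := Real.cosh_pos (p * b₂)
      have : (0 : ℝ) < p := by exact_mod_cast hp
      have : (0 : ℝ) < N := by exact_mod_cast hN
      positivity
    linarith
  have hb0 : 0 ≤ b := by linarith [hb.1]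
  have hset : {b : ℝ | 0 ≤ b ∧ hamiltonian J x = ∑ k : Fin N,
      localField J x k * Real.tanh (p * b * localField J x k)} = {b} := by
    ext c
    simp only [Set.mem_ofPred_eq, Set.mem_singleton_iff]
    constructor
    · rintro ⟨hc0, hc⟩
      exact hmono.injOn hc0 hb0 (by rw [hbH, hc]; rfl)
    · rintro rfl
      exact ⟨hb0, hbH.symm⟩
  refine ⟨b, ?_, abs_le.2 ⟨by linarith [hb.1], by linarith [hb.2]⟩⟩
  rw [mple, hset, Set.image_singleton, sInf_singleton]

end LocalField

/-- `√N`-consistency of the maximum pseudolikelihood estimate when the log-partition function is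
of order `N`. -/
lemma exists_isingProb_withinDist_mple {p : ℕ} (hp : 0 < p) {β c δ : ℝ} (hβ : 0 < β) (hc : 0 < c)
    (hδ : 0 < δ) :
    ∃ M : ℝ, 0 < M ∧ ∃ N₀ : ℕ, ∀ N ≥ N₀, ∀ J : Tensor p N, IsMeanFieldTensor J →
      c * N ≤ logPartitionFn J β →
      1 - δ < isingProb J β {x | WithinDist (mple J x) β (M / √(N : ℝ))} := by
  set C : ℝ := (2 + p * β) * (2 * p) + 4
  have hC : 0 < C := by positivity
  -- With this choice, configurations of energy below `εN` have weight at most `exp (cN/2)`, which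
  -- is negligible against `Z_N ≥ exp (cN)`.
  set ε : ℝ := c / (2 * β)
  have hε : 0 < ε := by positivity
  set κ : ℝ := p / Real.cosh (p * (β + 1)) ^ 2 * ε ^ 2
  have hκ : 0 < κ := by
    have := Real.cosh_pos (p * (β + 1))
    have : (0 : ℝ) < p := by exact_mod_cast hp
    positivity
  -- Chebyshev's inequality: the score exceeds `R√N` with probability at most `C / R² = δ / 4`.
  set R : ℝ := √(4 * C / δ)
  have hR : 0 < R := by positivity
  have hR2 : R ^ 2 = 4 * C / δ := Real.sq_sqrt (by positivity)
  set M : ℝ := R / κ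
  have hM : 0 < M := by positivity
  have hlim : Tendsto (fun N : ℕ => M / √(N : ℝ)) atTop (𝓝 0) :=
    tendsto_const_nhds.div_atTop (Real.tendsto_sqrt_atTop.comp tendsto_natCast_atTop_atTop)
  have hlim2 : Tendsto (fun N : ℕ => Real.exp (-(c / 2 * N))) atTop (𝓝 0) :=
    Real.tendsto_exp_neg_atTop_nhds_zero.comp
      (tendsto_natCast_atTop_atTop.const_mul_atTop (by positivity))
  have hev := (hlim.eventually_lt_const (show (0 : ℝ) < min 1 β by positivity)).and
    ((hlim2.eventually_lt_const (show 0 < δ / 2 by positivity)).and (eventually_gt_atTop 0))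
  obtain ⟨N₀, hN₀⟩ := eventually_atTop.1 hev
  refine ⟨M, hM, N₀, fun N hN J hJ hF => ?_⟩
  obtain ⟨h1, h2, hNpos⟩ := hN₀ N hN
  have hN' : (0 : ℝ) < N := by exact_mod_cast hNpos
  have hs : 0 < √(N : ℝ) := Real.sqrt_pos.2 hN'
  have hss : √(N : ℝ) * √(N : ℝ) = N := Real.mul_self_sqrt hN'.le
  set A : Set (Spins N) := {x | hamiltonian J x < ε * N}
  set B : Set (Spins N) := {x | R * √(N : ℝ) ≤ |hamiltonian J x - plFn J x β|}
  have hsub : {x | WithinDist (mple J x) β (M / √(N : ℝ))}ᶜ ⊆ A ∪ B := by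
    intro x hx
    by_contra hAB
    simp only [A, B, Set.mem_union, Set.mem_ofPred_eq, not_or, not_lt, not_le] at hAB
    refine hx (withinDist_mple hp hJ hNpos x hε hAB.1 (by positivity)
      (h1.le.trans (min_le_left _ _)) (h1.le.trans (min_le_right _ _)) (hAB.2.le.trans ?_))
    refine le_of_eq ?_
    change R * √(N : ℝ) = κ * N * (R / κ / √(N : ℝ))
    have hs2 : √(N : ℝ) ^ 2 = N := by rw [sq, hss]
    field_simp
    rw [hs2]
  have hA : isingProb J β A < δ / 2 := by
    refine lt_of_le_of_lt ?_ h2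
    have hZ := sum_exp_hamiltonian_pos J β
    rw [isingProb_eq, div_le_iff₀ hZ, ← two_pow_mul_partitionFn]
    have hle : ∀ x : Spins N, (if x ∈ A then Real.exp (β * hamiltonian J x) else 0) ≤
        Real.exp (c / 2 * N) := fun x => by
      split_ifs with hx
      · rw [Real.exp_le_exp]
        have : β * hamiltonian J x ≤ β * (ε * N) := by
          have : hamiltonian J x < ε * N := hx
          gcongr
        refine this.trans (le_of_eq ?_)
        simp only [ε]; field_simp
      · positivity
    classical
    refine le_trans (Finset.sum_le_sum fun x _ => ?_)
      (le_trans (Finset.sum_le_card_nsmul Finset.univ _ _ fun x _ => hle x) ?_)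
    · by_cases hx : x ∈ A <;> simp [hx]
    · have hcard : (Finset.univ : Finset (Spins N)).card = 2 ^ N := by
        simp [Finset.card_univ, Fintype.card_pi]
      rw [hcard, nsmul_eq_mul]
      have hZ2 : Real.exp (c * N) ≤ partitionFn J β :=
        (Real.le_log_iff_exp_le (partitionFn_pos J β)).1 hF
      have h3 : Real.exp (c / 2 * N) = Real.exp (-(c / 2 * N)) * Real.exp (c * N) := by
        rw [← Real.exp_add]; ring_nf
      rw [h3]
      push_cast
      have h4 : Real.exp (-(c / 2 * N)) * Real.exp (c * N) ≤
          Real.exp (-(c / 2 * N)) * partitionFn J β := by gcongr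
      have h5 : (0 : ℝ) < 2 ^ N := by positivity
      nlinarith
  have hB : isingProb J β B ≤ δ / 4 := by
    have h3 := isingProb_mul_le J β B (fun x => (∑ k, score J β k x) ^ 2) (fun x => sq_nonneg _)
      (R ^ 2 * N) (fun x hx => by
        rw [sum_score_eq hp, ← sq_abs (hamiltonian J x - plFn J x β)]
        refine le_trans (le_of_eq ?_) (pow_le_pow_left₀ (by positivity) hx 2)
        rw [mul_pow, sq √(N : ℝ), hss])
    have h4 := sum_exp_mul_score_sq_le hp hJ hβ.le
    rw [← div_le_iff₀ (sum_exp_hamiltonian_pos J β)] at h4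
    have h5 := h3.trans h4
    rw [hR2] at h5
    have h6 : isingProb J β B * (4 * C / δ * N) ≤ δ / 4 * (4 * C / δ * N) := by
      rw [mul_comm]
      refine h5.trans (le_of_eq ?_)
      change (N : ℝ) * C = _
      field_simp
    exact le_of_mul_le_mul_right h6 (by positivity)
  have h7 := (isingProb_mono J β hsub).trans (isingProb_union_le J β A B)
  rw [isingProb_compl] at h7
  linarith

/-! ### Blocks -/

section Blocks

variable {K : ℕ} {lam : Fin K → ℝ}

lemma block_unique (h0 : ∀ j, 0 ≤ lam j) {N : ℕ} {v : Fin N} {j j' : Fin K}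
    (hj : v ∈ block lam N j) (hj' : v ∈ block lam N j') : j = j' := by
  have aux : ∀ {j j' : Fin K}, v ∈ block lam N j → v ∈ block lam N j' → ¬ j < j' := by
    intro j j' hj hj' hlt
    have hs : ∑ i ∈ Finset.Iic j, lam i ≤ ∑ i ∈ Finset.Iio j', lam i := by
      refine Finset.sum_le_sum_of_subset_of_nonneg (fun i hi => ?_) fun i _ _ => h0 i
      rw [Finset.mem_Iio]
      exact (Finset.mem_Iic.1 hi).trans_lt hlt
    have := mul_le_mul_of_nonneg_left hs (Nat.cast_nonneg (α := ℝ) N)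
    linarith [hj.2, hj'.1]
  exact le_antisymm (not_lt.1 (aux hj' hj)) (not_lt.1 (aux hj hj'))

lemma exists_mem_block (h1 : ∑ j, lam j = 1) {N : ℕ} (v : Fin N) :
    ∃ j, v ∈ block lam N j := by
  have hv : (v.val : ℝ) + 1 ≤ N := by exact_mod_cast v.2
  have hne : {j : Fin K | (v.val : ℝ) + 1 ≤ N * ∑ i ∈ Finset.Iic j, lam i}.Nonempty := by
    rcases K with _ | K
    · simp at h1
    · refine ⟨Fin.last K, ?_⟩
      have : Finset.Iic (Fin.last K) = Finset.univ := by ext; simp [Fin.le_last]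
      rw [Set.mem_ofPred_eq, this, h1, mul_one]
      exact hv
  -- The least label whose right endpoint reaches the vertex; minimality places the vertex beyond
  -- the left endpoint, which is the right endpoint of the preceding label.
  obtain ⟨j, hj, hmin⟩ := wellFounded_lt.has_min _ hne
  refine ⟨j, ?_, hj⟩
  obtain ⟨n, hn⟩ := j
  rcases n with _ | n
  · have : Finset.Iio (⟨0, hn⟩ : Fin K) = ∅ := by ext; simp [Fin.lt_def]
    rw [this, Finset.sum_empty, mul_zero]
    positivity
  · have h2 : Finset.Iio (⟨n + 1, hn⟩ : Fin K) = Finset.Iic ⟨n, by omega⟩ := by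
      ext i; simp only [Finset.mem_Iio, Finset.mem_Iic, Fin.lt_def, Fin.le_def]; omega
    by_contra hcon
    rw [h2, not_lt] at hcon
    exact hmin _ hcon (by simp [Fin.lt_def])

lemma card_filter_add_one_le {N : ℕ} {x : ℝ} (h0 : 0 ≤ x) (hN : x ≤ N) :
    (Finset.univ.filter fun v : Fin N => (v.val : ℝ) + 1 ≤ x).card = ⌊x⌋₊ := by
  have h : (Finset.univ.filter fun v : Fin N => (v.val : ℝ) + 1 ≤ x) =
      Finset.univ.filter fun v : Fin N => v.val < ⌊x⌋₊ := by
    ext v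
    simp only [Finset.mem_filter, Finset.mem_univ, true_and]
    rw [← Nat.succ_le_iff, Nat.le_floor_iff h0]
    push_cast
    rfl
  have h2 : ⌊x⌋₊ ≤ N := by
    have := Nat.floor_le_floor hN
    simpa using this
  rw [h, Fin.card_filter_val_lt]
  omega

/-- The block size is a difference of two floors. -/
lemma abs_card_block_sub_le (h0 : ∀ j, 0 ≤ lam j) (h1 : ∑ j, lam j = 1) {N : ℕ}
    {b : Fin N → Fin K} (hb : ∀ v, v ∈ block lam N (b v)) (j : Fin K) :
    |((Finset.univ.filter fun v => b v = j).card : ℝ) - N * lam j| ≤ 1 := by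
  classical
  set A := ∑ i ∈ Finset.Iio j, lam i
  set B := ∑ i ∈ Finset.Iic j, lam i
  have hAB : B = A + lam j := by
    simp only [A, B]
    rw [← Finset.Iio_insert, Finset.sum_insert (by simp), add_comm]
  have hA0 : 0 ≤ A := Finset.sum_nonneg fun i _ => h0 i
  have hB1 : B ≤ 1 := by
    rw [← h1]
    exact Finset.sum_le_sum_of_subset_of_nonneg (Finset.subset_univ _) fun i _ _ => h0 i
  have hl := h0 j
  have hN : (0 : ℝ) ≤ N := Nat.cast_nonneg N
  have hNA : 0 ≤ N * A := mul_nonneg hN hA0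
  have hNB : N * B ≤ N := by nlinarith
  have hNAB : N * A ≤ N * B := by nlinarith
  have hset : (Finset.univ.filter fun v => b v = j) =
      (Finset.univ.filter fun v : Fin N => (v.val : ℝ) + 1 ≤ N * B) \
        (Finset.univ.filter fun v : Fin N => (v.val : ℝ) + 1 ≤ N * A) := by
    ext v
    simp only [Finset.mem_filter, Finset.mem_univ, true_and, Finset.mem_sdiff, not_le]
    constructor
    · rintro rfl
      exact ⟨(hb v).2, (hb v).1⟩
    · intro h
      exact block_unique h0 (hb v) ⟨h.2, h.1⟩
  have hsub : (Finset.univ.filter fun v : Fin N => (v.val : ℝ) + 1 ≤ N * A) ⊆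
      (Finset.univ.filter fun v : Fin N => (v.val : ℝ) + 1 ≤ N * B) := by
    intro v hv
    simp only [Finset.mem_filter, Finset.mem_univ, true_and] at hv ⊢
    linarith
  rw [hset, Finset.card_sdiff_of_subset hsub, card_filter_add_one_le hNA (hNAB.trans hNB),
    card_filter_add_one_le (hNA.trans hNAB) hNB, Nat.cast_sub (Nat.floor_le_floor hNAB)]
  have e1 := Nat.floor_le hNA
  have e2 := Nat.floor_le (hNA.trans hNAB)
  have e3 := Nat.lt_floor_add_one (N * A)
  have e4 := Nat.lt_floor_add_one (N * B)
  rw [hAB] at e2 e4 ⊢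
  rw [abs_le]
  constructor <;> nlinarith

end Blocks

/-! ### The hypergraph stochastic block model -/

section HSBM

variable {p K N : ℕ} {lam : Fin K → ℝ} {Θ : (Fin p → Fin K) → unitInterval}

instance (lam : Fin K → ℝ) (Θ : (Fin p → Fin K) → unitInterval) (N : ℕ) :
    IsProbabilityMeasure (hsbmLaw lam Θ N) := by
  unfold hsbmLaw; infer_instance

lemma injective_of_image_eq {e : HyperEdge p N} {i : Fin p → Fin N}
    (h : Finset.univ.image i = e.1) : Function.Injective i := by
  have hc : (Finset.univ.image i).card = (Finset.univ : Finset (Fin p)).card := by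
    rw [h, e.2]; simp
  have := Finset.card_image_iff.1 hc
  rw [Finset.coe_univ] at this
  exact Set.injOn_univ.1 this

/-- Any enumeration of the hyperedge differs from the increasing one by a permutation, which `Θ`
does not see. -/
lemma edgeProb_eq (h0 : ∀ j, 0 ≤ lam j)
    (hΘ : ∀ (σ : Equiv.Perm (Fin p)) (j : Fin p → Fin K), Θ (j ∘ σ) = Θ j)
    {b : Fin N → Fin K} (hb : ∀ v, v ∈ block lam N (b v)) (e : HyperEdge p N)
    {i : Fin p → Fin N} (hi : Finset.univ.image i = e.1) :
    edgeProb lam Θ N e = Θ (b ∘ i) := by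
  have hex : ∃ j : Fin p → Fin K, ∀ l, e.1.orderEmbOfFin e.2 l ∈ block lam N (j l) :=
    ⟨fun l => b (e.1.orderEmbOfFin e.2 l), fun l => hb _⟩
  have hch : hex.choose = b ∘ (e.1.orderEmbOfFin e.2) := by
    ext l
    rw [block_unique h0 (hex.choose_spec l) (hb _)]
    rfl
  rw [edgeProb, dif_pos hex, hch]
  have hinj := injective_of_image_eq hi
  have hmem : ∀ l, ∃ l', e.1.orderEmbOfFin e.2 l' = i l := fun l => by
    have : i l ∈ Set.range (e.1.orderEmbOfFin e.2) := by
      rw [Finset.range_orderEmbOfFin, ← hi]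
      simp
    exact this
  choose σ hσ using hmem
  have hσi : Function.Injective σ := fun a c hac => hinj (by rw [← hσ, ← hσ, hac])
  rw [← hΘ (Equiv.ofBijective σ (Finite.injective_iff_bijective.1 hσi))]
  congr 1
  ext l
  simp [hσ]

lemma isMeanFieldTensor_hsbmTensor (G : UniformHypergraph p N) :
    IsMeanFieldTensor (hsbmTensor G) where
  symm σ i := by
    have h : Finset.univ.image (i ∘ σ) = Finset.univ.image i := by
      ext v
      simp only [Finset.mem_image, Finset.mem_univ, true_and, Function.comp_apply]
      exact ⟨fun ⟨l, hl⟩ => ⟨σ l, hl⟩, fun ⟨l, hl⟩ => ⟨σ.symm l, by simpa using hl⟩⟩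
    simp only [hsbmTensor, adjTensor, h]
  supp i hi := by
    have h : ¬ ∃ e : HyperEdge p N, G e = true ∧ Finset.univ.image i = e.1 :=
      fun ⟨e, _, he⟩ => hi (injective_of_image_eq he)
    simp only [hsbmTensor, adjTensor, h, if_false, zero_div]
  bound i := by
    rw [hsbmTensor, abs_div, abs_of_nonneg (show (0 : ℝ) ≤ (N : ℝ) ^ (p - 1) by positivity)]
    refine div_le_div_of_nonneg_right ?_ (by positivity)
    rw [adjTensor]
    split_ifs <;> simp

open Classical in
-- Grouping tuples by their vertex set exhibits a linear statistic of the tensor as a sum over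
-- independent edge indicators.
lemma sum_adjTensor_mul (G : UniformHypergraph p N) (f : (Fin p → Fin N) → ℝ) :
    ∑ i, adjTensor G i * f i =
      ∑ e : HyperEdge p N, if G e = true then
        ∑ i : Fin p → Fin N with Finset.univ.image i = e.1, f i else 0 := by
  have h : ∀ i : Fin p → Fin N, adjTensor G i * f i =
      ∑ e : HyperEdge p N, if G e = true then
        (if Finset.univ.image i = e.1 then f i else 0) else 0 := fun i => by
    rw [adjTensor]
    split_ifs with hex
    · obtain ⟨e, he, hie⟩ := hex
      rw [Finset.sum_eq_single e]
      · simp [he, hie]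
      · intro e' _ hne
        have : ¬ Finset.univ.image i = e'.1 := fun h => hne (Subtype.ext (h.symm.trans hie))
        simp [this]
      · simp
    · symm
      rw [zero_mul]
      refine Finset.sum_eq_zero fun e _ => ?_
      split_ifs with h1 h2
      · exact absurd ⟨e, h1, h2⟩ hex
      all_goals rfl
  simp only [h]
  rw [Finset.sum_comm]
  refine Finset.sum_congr rfl fun e _ => ?_
  split_ifs
  · rw [Finset.sum_filter]
  · simp

open Classical in
lemma sum_edgeProb_mul (h0 : ∀ j, 0 ≤ lam j)
    (hΘ : ∀ (σ : Equiv.Perm (Fin p)) (j : Fin p → Fin K), Θ (j ∘ σ) = Θ j)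
    {b : Fin N → Fin K} (hb : ∀ v, v ∈ block lam N (b v)) (f : (Fin p → Fin N) → ℝ) :
    ∑ e : HyperEdge p N, (edgeProb lam Θ N e : ℝ) *
      ∑ i : Fin p → Fin N with Finset.univ.image i = e.1, f i =
      ∑ i : Fin p → Fin N with Function.Injective i, (Θ (b ∘ i) : ℝ) * f i := by
  simp only [Finset.mul_sum, Finset.sum_filter]
  rw [Finset.sum_comm]
  refine Finset.sum_congr rfl fun i _ => ?_
  split_ifs with hi
  · have hc : (Finset.univ.image i).card = p := by
      rw [Finset.card_image_of_injective _ hi]; simp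
    rw [Finset.sum_eq_single ⟨Finset.univ.image i, hc⟩]
    · simp [edgeProb_eq h0 hΘ hb ⟨Finset.univ.image i, hc⟩ rfl]
    · intro e' _ hne
      have : ¬ Finset.univ.image i = e'.1 := fun h => hne (Subtype.ext h.symm)
      simp [this]
    · simp
  · refine Finset.sum_eq_zero fun e _ => ?_
    rw [if_neg fun h => hi (injective_of_image_eq h), mul_zero]

open Classical in
lemma abs_sum_image_eq_le (e : HyperEdge p N) {f : (Fin p → Fin N) → ℝ} (hf : ∀ i, |f i| ≤ 1) :
    |∑ i : Fin p → Fin N with Finset.univ.image i = e.1, f i| ≤ (p : ℝ) ^ p := by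
  refine (Finset.abs_sum_le_sum_abs _ _).trans ?_
  refine (Finset.sum_le_card_nsmul _ _ 1 fun i _ => hf i).trans ?_
  have hsub : (Finset.univ.filter fun i : Fin p → Fin N => Finset.univ.image i = e.1) ⊆
      Fintype.piFinset fun _ => e.1 := by
    intro i hi
    rw [Fintype.mem_piFinset]
    intro l
    rw [← (Finset.mem_filter.1 hi).2]
    simp
  have hcard := Finset.card_le_card hsub
  simp only [Fintype.card_piFinset, e.2, Finset.prod_const, Finset.card_univ,
    Fintype.card_fin] at hcard
  rw [nsmul_eq_mul, mul_one]
  exact_mod_cast hcard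

/-- By independence it suffices to treat one edge, where `1 + θ(exp w - 1) ≤ exp (θw + w²)` because
`exp w - 1 - w ≤ w²` for `|w| ≤ 1`. -/
lemma integral_exp_sum_edges_le (w : HyperEdge p N → ℝ) (hw : ∀ e, |w e| ≤ 1) :
    ∫ G, Real.exp (∑ e, if G e = true then w e else 0) ∂(hsbmLaw lam Θ N) ≤
      Real.exp (∑ e, (edgeProb lam Θ N e : ℝ) * w e + ∑ e, w e ^ 2) := by
  have h1 : ∀ G : UniformHypergraph p N, Real.exp (∑ e, if G e = true then w e else 0) =
      ∏ e, Real.exp (if G e = true then w e else 0) := fun G => Real.exp_sum _ _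
  simp only [h1]
  rw [hsbmLaw, integral_fintype_prod_eq_prod
    (f := fun e (u : Bool) => Real.exp (if u = true then w e else 0)), ← Finset.sum_add_distrib,
    Real.exp_sum]
  refine Finset.prod_le_prod (fun e _ => integral_nonneg fun u => (Real.exp_pos _).le)
    fun e _ => ?_
  rw [integral_bernoulliMeasure]
  set θ := (edgeProb lam Θ N e : ℝ)
  have hθ0 : 0 ≤ θ := (edgeProb lam Θ N e).2.1
  have hθ1 : θ ≤ 1 := (edgeProb lam Θ N e).2.2
  have h2 := Real.abs_exp_sub_one_sub_id_le (hw e)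
  have h3 := (abs_le.1 h2).2
  have h4 := Real.add_one_le_exp (θ * (Real.exp (w e) - 1))
  have h5 : θ * (Real.exp (w e) - 1) ≤ θ * w e + w e ^ 2 := by
    nlinarith [sq_nonneg (w e)]
  have h6 := Real.exp_le_exp.2 h5
  simp
  nlinarith

open Classical in
-- Each edge carries a weight of order `N^{-(p-1)}` and there are at most `N^p` edges, so the
-- squared weights total `O(N^{2-p})`. This is bounded exactly because `p ≥ 2`, and averaging over
-- the graph costs only a constant factor.
lemma integral_exp_adjTensor_le (hp : 2 ≤ p) (h0 : ∀ j, 0 ≤ lam j)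
    (hΘ : ∀ (σ : Equiv.Perm (Fin p)) (j : Fin p → Fin K), Θ (j ∘ σ) = Θ j)
    {b : Fin N → Fin K} (hb : ∀ v, v ∈ block lam N (b v)) {β : ℝ} (hβ : 0 ≤ β) (hN : 0 < N)
    (hβN : β * (p : ℝ) ^ p ≤ N) {f : (Fin p → Fin N) → ℝ} (hf : ∀ i, |f i| ≤ 1) :
    ∫ G, Real.exp (β / (N : ℝ) ^ (p - 1) * ∑ i, adjTensor G i * f i) ∂(hsbmLaw lam Θ N) ≤
      Real.exp ((β * (p : ℝ) ^ p) ^ 2) * Real.exp (β / (N : ℝ) ^ (p - 1) *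
        ∑ i : Fin p → Fin N with Function.Injective i, (Θ (b ∘ i) : ℝ) * f i) := by
  set a : ℝ := β / (N : ℝ) ^ (p - 1)
  have hN1 : (1 : ℝ) ≤ N := by exact_mod_cast hN
  have ha0 : 0 ≤ a := by positivity
  have hNp : (0 : ℝ) < (N : ℝ) ^ (p - 1) := by positivity
  have hapN : a * (p : ℝ) ^ p = β * (p : ℝ) ^ p / (N : ℝ) ^ (p - 1) := by
    simp only [a]; ring
  have ha1 : a * (p : ℝ) ^ p ≤ 1 := by
    rw [hapN, div_le_one hNp]
    exact hβN.trans (le_self_pow₀ hN1 (by omega))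
  set w : HyperEdge p N → ℝ := fun e =>
    a * ∑ i : Fin p → Fin N with Finset.univ.image i = e.1, f i
  have hw : ∀ e, |w e| ≤ a * (p : ℝ) ^ p := fun e => by
    rw [abs_mul, abs_of_nonneg ha0]
    exact mul_le_mul_of_nonneg_left (abs_sum_image_eq_le e hf) ha0
  have h1 : ∀ G : UniformHypergraph p N, a * ∑ i, adjTensor G i * f i =
      ∑ e, if G e = true then w e else 0 := fun G => by
    rw [sum_adjTensor_mul, Finset.mul_sum]
    refine Finset.sum_congr rfl fun e _ => ?_
    split_ifs <;> simp [w]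
  simp only [h1]
  refine (integral_exp_sum_edges_le w fun e => (hw e).trans ha1).trans ?_
  rw [← Real.exp_add, Real.exp_le_exp, add_comm]
  refine add_le_add ?_ (le_of_eq ?_)
  · have h2 : ∀ e, w e ^ 2 ≤ (a * (p : ℝ) ^ p) ^ 2 := fun e => by
      rw [← sq_abs]; exact pow_le_pow_left₀ (abs_nonneg _) (hw e) 2
    refine (Finset.sum_le_card_nsmul _ _ _ fun e _ => h2 e).trans ?_
    rw [Finset.card_univ, Fintype.card_finset_len, Fintype.card_fin, nsmul_eq_mul, hapN, div_pow,
      mul_div_assoc', div_le_iff₀ (by positivity), mul_comm]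
    refine mul_le_mul_of_nonneg_left ?_ (by positivity)
    rw [← pow_mul]
    refine le_trans (by exact_mod_cast Nat.choose_le_pow N p) (pow_le_pow_right₀ hN1 ?_)
    omega
  · rw [← sum_edgeProb_mul h0 hΘ hb, Finset.mul_sum]
    exact Finset.sum_congr rfl fun e _ => by simp only [w]; ring

end HSBM

/-! ### The entropy function -/

lemma continuous_binEntropyI : Continuous binEntropyI := by
  unfold binEntropyI
  have h := Real.continuous_mul_log
  have h1 : Continuous fun t : ℝ => (1 + t) * Real.log (1 + t) := h.comp (by fun_prop)
  have h2 : Continuous fun t : ℝ => (1 - t) * Real.log (1 - t) := h.comp (by fun_prop)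
  exact (h1.add h2).div_const 2

lemma binEntropyI_zero : binEntropyI 0 = 0 := by simp [binEntropyI]

lemma binEntropyI_neg (t : ℝ) : binEntropyI (-t) = binEntropyI t := by
  simp only [binEntropyI, sub_neg_eq_add, ← sub_eq_add_neg]; ring

lemma binEntropyI_abs (t : ℝ) : binEntropyI |t| = binEntropyI t := by
  rcases abs_choice t with h | h <;> rw [h]
  exact binEntropyI_neg t

lemma binEntropyI_nonneg {t : ℝ} (ht : |t| ≤ 1) : 0 ≤ binEntropyI t := by
  have aux : ∀ y : ℝ, 0 ≤ y → y - 1 ≤ y * Real.log y := fun y hy => by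
    rcases hy.eq_or_lt with rfl | hy
    · simp
    · have h := Real.log_le_sub_one_of_pos (inv_pos.2 hy)
      rw [Real.log_inv] at h
      have h2 := mul_le_mul_of_nonneg_left h hy.le
      rw [mul_sub, mul_inv_cancel₀ hy.ne'] at h2
      linarith
  have h := abs_le.1 ht
  have h1 := aux (1 + t) (by linarith)
  have h2 := aux (1 - t) (by linarith)
  rw [binEntropyI]
  linarith

/-- The bound `log y ≤ y - 1` in fact yields `I(t) ≤ t²`. -/
lemma binEntropyI_le_one {t : ℝ} (ht : |t| ≤ 1) : binEntropyI t ≤ 1 := by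
  have aux : ∀ y : ℝ, 0 ≤ y → y * Real.log y ≤ y * (y - 1) := fun y hy => by
    rcases hy.eq_or_lt with rfl | hy
    · simp
    · exact mul_le_mul_of_nonneg_left (Real.log_le_sub_one_of_pos hy) hy.le
  have h := abs_le.1 ht
  have h1 := aux (1 + t) (by linarith)
  have h2 := aux (1 - t) (by linarith)
  rw [binEntropyI]
  nlinarith

/-! ### Exponential moments of the entropy of the empirical mean -/

section SignSum

variable {ι : Type*} [Fintype ι]

/-- The sum of a family of signs. -/
def signSum (y : ι → ℤˣ) : ℝ := ∑ i, ((y i : ℤ) : ℝ)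

/-- The mean of a family of signs. -/
noncomputable def signMean (y : ι → ℤˣ) : ℝ := signSum y / Fintype.card ι

lemma abs_signSum_le (y : ι → ℤˣ) : |signSum y| ≤ Fintype.card ι := by
  refine (Finset.abs_sum_le_sum_abs _ _).trans (le_of_eq ?_)
  have : ∀ i, |((y i : ℤ) : ℝ)| = 1 := fun i => by
    rcases Int.units_eq_one_or (y i) with h | h <;> simp [h]
  simp [this]

lemma card_mul_signMean (y : ι → ℤˣ) : Fintype.card ι * signMean y = signSum y := by
  rw [signMean]
  rcases (Nat.cast_nonneg (α := ℝ) (Fintype.card ι)).eq_or_lt with h | h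
  · have := abs_signSum_le y
    rw [← h] at this ⊢
    have := abs_nonpos_iff.1 this
    rw [this]; simp
  · field_simp

lemma abs_signMean_le (y : ι → ℤˣ) : |signMean y| ≤ 1 := by
  rw [signMean, abs_div, Nat.abs_cast]
  exact div_le_one_of_le₀ (abs_signSum_le y) (Nat.cast_nonneg _)

lemma signSum_neg (y : ι → ℤˣ) : signSum (-y) = - signSum y := by
  simp [signSum]

variable [DecidableEq ι]

/-- Chernoff by change of measure: the log-density of the tilted law is affine and nondecreasing in
the sum, so on this event the tilted mass of each configuration is at least `exp (n I(t)) / 2^n`,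
while the total mass is one. -/
lemma card_le_signSum_of_lt_one {t : ℝ} (h0 : 0 ≤ t) (h1 : t < 1) :
    ((Finset.univ.filter fun y : ι → ℤˣ => Fintype.card ι * t ≤ signSum y).card : ℝ) ≤
      2 ^ Fintype.card ι * Real.exp (-(Fintype.card ι * binEntropyI t)) := by
  set n := Fintype.card ι
  have ht : |t| < 1 := by rwa [abs_of_nonneg h0]
  set A := (Real.log (1 + t) + Real.log (1 - t)) / 2
  set B := (Real.log (1 + t) - Real.log (1 - t)) / 2
  have hB : 0 ≤ B := by
    have := Real.log_le_log (by linarith : 0 < 1 - t) (by linarith : 1 - t ≤ 1 + t)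
    simp only [B]; linarith
  have hlog : ∀ y : ι → ℤˣ, Real.log (2 ^ n * tilt (fun _ => t) y) = n * A + B * signSum y :=
    fun y => by
    rw [log_tilt (fun _ => ht), signSum, Finset.mul_sum]
    have : ∀ i, Real.log (1 + t * ((y i : ℤ) : ℝ)) = A + B * ((y i : ℤ) : ℝ) := fun i => by
      rcases Int.units_eq_one_or (y i) with h | h
      · simp [h, A, B]; ring
      · simp only [h, A, B, Units.val_neg, Units.val_one, Int.cast_neg, Int.cast_one, mul_neg,
          mul_one, ← sub_eq_add_neg]
        ring
    simp only [this, Finset.sum_add_distrib]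
    simp [n]
  have hge : ∀ y : ι → ℤˣ, n * t ≤ signSum y →
      Real.exp (n * binEntropyI t) / 2 ^ n ≤ tilt (fun _ => t) y := fun y hy => by
    have hpos := tilt_pos (fun _ : ι => ht) y
    rw [div_le_iff₀ (by positivity), mul_comm (tilt _ y), ← Real.le_log_iff_exp_le (by positivity),
      hlog]
    have h2 := mul_le_mul_of_nonneg_left hy hB
    have h3 : (n : ℝ) * binEntropyI t = n * A + B * (n * t) := by
      simp only [binEntropyI, A, B]; ring
    linarith
  have hsum := sum_tilt (fun _ : ι => t)
  have h2 : ((Finset.univ.filter fun y : ι → ℤˣ => n * t ≤ signSum y).card : ℝ) *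
      (Real.exp (n * binEntropyI t) / 2 ^ n) ≤ 1 := by
    rw [← hsum, ← nsmul_eq_mul]
    refine (Finset.card_nsmul_le_sum _ _ _ fun y hy => hge y (Finset.mem_filter.1 hy).2).trans ?_
    exact Finset.sum_le_sum_of_subset_of_nonneg (Finset.filter_subset _ _)
      fun y _ _ => (tilt_pos (fun _ => ht) y).le
  rw [Real.exp_neg]
  rw [← mul_div_assoc, div_le_iff₀ (by positivity), one_mul] at h2
  rw [← div_eq_mul_inv, le_div_iff₀ (Real.exp_pos _)]
  exact h2

lemma card_le_signSum {t : ℝ} (h0 : 0 ≤ t) (h1 : t ≤ 1) :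
    ((Finset.univ.filter fun y : ι → ℤˣ => Fintype.card ι * t ≤ signSum y).card : ℝ) ≤
      2 ^ Fintype.card ι * Real.exp (-(Fintype.card ι * binEntropyI t)) := by
  have hcont : Continuous fun r : ℝ =>
      2 ^ Fintype.card ι * Real.exp (-(Fintype.card ι * binEntropyI (r * t))) := by
    have := continuous_binEntropyI.comp (continuous_id.mul (continuous_const (y := t)))
    exact continuous_const.mul (Real.continuous_exp.comp (continuous_const.mul this).neg)
  have hlim := (hcont.tendsto 1).mono_left (nhdsWithin_le_nhds (s := Set.Iio 1))
  simp only [one_mul] at hlim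
  refine ge_of_tendsto hlim ?_
  -- At `t = 1` the tilted law degenerates, so the bound is obtained as the limit of those at `r *
  -- t` with `r ↑ 1`.
  filter_upwards [Ioo_mem_nhdsLT (zero_lt_one (α := ℝ))] with r hr
  have hrt : r * t ≤ t := mul_le_of_le_one_left h0 hr.2.le
  have hrt1 : r * t < 1 := by nlinarith [hr.1, hr.2]
  refine le_trans ?_ (card_le_signSum_of_lt_one (mul_nonneg hr.1.le h0) hrt1)
  refine Nat.cast_le.2 (Finset.card_le_card fun y hy => ?_)
  simp only [Finset.mem_filter, Finset.mem_univ, true_and] at hy ⊢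
  exact (mul_le_mul_of_nonneg_left hrt (Nat.cast_nonneg _)).trans hy

lemma card_le_entropy_signMean (k : ℝ) :
    ((Finset.univ.filter fun y : ι → ℤˣ =>
      k ≤ Fintype.card ι * binEntropyI (signMean y)).card : ℝ) ≤
      2 * 2 ^ Fintype.card ι * Real.exp (-k) := by
  set n := Fintype.card ι
  set T := Finset.univ.filter fun y : ι → ℤˣ => k ≤ n * binEntropyI (signMean y)
  rcases T.eq_empty_or_nonempty with hT | hT
  · rw [hT]; simp; positivity
  -- Taking the least `|mean|` attained in `T` as the threshold avoids inverting the entropy or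
  -- using its monotonicity: `T` lies in the two tails beyond it.
  obtain ⟨y₀, hy₀, hmin⟩ := T.exists_min_image (fun y => |signMean y|) hT
  set t := |signMean y₀|
  set P := Finset.univ.filter fun y : ι → ℤˣ => n * t ≤ signSum y
  set Q := Finset.univ.filter fun y : ι → ℤˣ => n * t ≤ signSum (-y)
  have hQ : Q.card = P.card := by
    refine Finset.card_bij (fun y _ => -y) (fun y hy => ?_) (fun y _ z _ h => neg_injective h)
      (fun y hy => ⟨-y, ?_, neg_neg y⟩)
    · exact Finset.mem_filter.2 ⟨Finset.mem_univ _, (Finset.mem_filter.1 hy).2⟩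
    · refine Finset.mem_filter.2 ⟨Finset.mem_univ _, ?_⟩
      rw [neg_neg]
      exact (Finset.mem_filter.1 hy).2
  have hsub : T ⊆ P ∪ Q := by
    intro y hy
    have h1 : n * t ≤ |signSum y| := by
      rw [← card_mul_signMean, abs_mul, Nat.abs_cast]
      exact mul_le_mul_of_nonneg_left (hmin y hy) (Nat.cast_nonneg _)
    rw [Finset.mem_union]
    rcases le_abs.1 h1 with h | h
    · exact Or.inl (Finset.mem_filter.2 ⟨Finset.mem_univ _, h⟩)
    · exact Or.inr (Finset.mem_filter.2 ⟨Finset.mem_univ _, by rwa [signSum_neg]⟩)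
  have hP := card_le_signSum (ι := ι) (abs_nonneg (signMean y₀)) (abs_signMean_le y₀)
  have hk : k ≤ n * binEntropyI t := by
    simp only [t, binEntropyI_abs]
    exact (Finset.mem_filter.1 hy₀).2
  have h2 : (T.card : ℝ) ≤ P.card + Q.card := by
    exact_mod_cast (Finset.card_le_card hsub).trans (Finset.card_union_le P Q)
  rw [hQ] at h2
  have h3 : Real.exp (-(n * binEntropyI t)) ≤ Real.exp (-k) := Real.exp_le_exp.2 (by linarith)
  have h4 : (2 : ℝ) ^ n * Real.exp (-(n * binEntropyI t)) ≤ 2 ^ n * Real.exp (-k) := by gcongr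
  have h5 : (P.card : ℝ) ≤ 2 ^ n * Real.exp (-(n * binEntropyI t)) := hP
  linarith

/-- Slice by the integer part `k` of the entropy. Slice `k` has probability at most `2 exp (-k)` and
weight at most `exp (γ(k + 1))`, so the slices are dominated by a geometric series of ratio `exp
(-(1 - γ))`. -/
lemma sum_exp_entropy_signMean_le {γ : ℝ} (hγ0 : 0 ≤ γ) (hγ1 : γ < 1) :
    ∑ y : ι → ℤˣ, Real.exp (γ * (Fintype.card ι * binEntropyI (signMean y))) ≤
      2 ^ Fintype.card ι * (2 * Real.exp γ * (1 - Real.exp (-(1 - γ)))⁻¹) := by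
  set n := Fintype.card ι
  have h1 : ∀ y : ι → ℤˣ, Real.exp (γ * (n * binEntropyI (signMean y))) ≤
      ∑ k ∈ Finset.range (n + 1), if (k : ℝ) ≤ n * binEntropyI (signMean y) then
        Real.exp (γ * (k + 1)) else 0 := fun y => by
    set Y := (n : ℝ) * binEntropyI (signMean y)
    have hY0 : 0 ≤ Y := mul_nonneg (Nat.cast_nonneg _) (binEntropyI_nonneg (abs_signMean_le y))
    have hYn : Y ≤ n := mul_le_of_le_one_right (Nat.cast_nonneg _)
      (binEntropyI_le_one (abs_signMean_le y))
    have hk : ⌊Y⌋₊ ∈ Finset.range (n + 1) := by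
      rw [Finset.mem_range, Nat.lt_succ_iff]
      have := Nat.floor_le_floor hYn
      simpa using this
    refine le_trans ?_ (Finset.single_le_sum (fun k _ => ?_) hk)
    · rw [if_pos (Nat.floor_le hY0), Real.exp_le_exp]
      exact mul_le_mul_of_nonneg_left (Nat.lt_floor_add_one Y).le hγ0
    · positivity
  refine (Finset.sum_le_sum fun y _ => h1 y).trans ?_
  rw [Finset.sum_comm]
  set q := Real.exp (-(1 - γ))
  have hq0 : 0 ≤ q := (Real.exp_pos _).le
  have hq1 : q < 1 := by
    rw [← Real.exp_zero]; exact Real.exp_lt_exp.2 (by linarith)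
  have h2 : ∀ k : ℕ, (∑ y : ι → ℤˣ, if (k : ℝ) ≤ n * binEntropyI (signMean y) then
      Real.exp (γ * (k + 1)) else 0) ≤ 2 ^ n * (2 * Real.exp γ) * q ^ k := fun k => by
    rw [← Finset.sum_filter, Finset.sum_const, nsmul_eq_mul]
    have h := card_le_entropy_signMean (ι := ι) (k : ℝ)
    refine (mul_le_mul_of_nonneg_right h (Real.exp_pos _).le).trans (le_of_eq ?_)
    have e : Real.exp (-(k : ℝ)) * Real.exp (γ * (k + 1)) = Real.exp γ * q ^ k := by
      simp only [q]
      rw [← Real.exp_nat_mul, ← Real.exp_add, ← Real.exp_add]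
      ring_nf
    rw [mul_assoc, e]; ring
  refine (Finset.sum_le_sum fun k _ => h2 k).trans ?_
  rw [← Finset.mul_sum, mul_assoc, mul_assoc]
  have h3 := (summable_geometric_of_lt_one hq0 hq1).sum_le_tsum (Finset.range (n + 1))
    fun k _ => pow_nonneg hq0 k
  rw [tsum_geometric_of_lt_one hq0 hq1] at h3
  rw [mul_assoc]
  gcongr

end SignSum

/-- Sums of products over the fibers of a map factorize. -/
lemma sum_prod_fibers {ι κ α : Type*} [Fintype ι] [DecidableEq ι] [Fintype κ] [DecidableEq κ]
    [Fintype α] (b : ι → κ) (g : ∀ j, ({i // b i = j} → α) → ℝ) :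
    ∑ x : ι → α, ∏ j, g j (fun i => x i) = ∏ j, ∑ y, g j y := by
  rw [Finset.prod_univ_sum, Fintype.piFinset_univ]
  let E : (ι → α) ≃ (∀ j, {i // b i = j} → α) :=
    { toFun := fun x j i => x i.1
      invFun := fun y i => y (b i) ⟨i, rfl⟩
      left_inv := fun x => rfl
      right_inv := fun y => by
        funext j i
        obtain ⟨i, rfl⟩ := i
        rfl }
  exact Fintype.sum_equiv E _ _ fun x => rfl

/-- Replace the factors one at a time. -/
lemma abs_prod_sub_prod_le {α : Type*} (s : Finset α) (a c : α → ℝ) (ha : ∀ l, |a l| ≤ 1)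
    (hc : ∀ l, |c l| ≤ 1) : |∏ l ∈ s, a l - ∏ l ∈ s, c l| ≤ ∑ l ∈ s, |a l - c l| := by
  classical
  induction s using Finset.induction_on with
  | empty => simp
  | insert x s hx ih =>
    rw [Finset.prod_insert hx, Finset.prod_insert hx, Finset.sum_insert hx]
    have e : a x * ∏ l ∈ s, a l - c x * ∏ l ∈ s, c l =
        (a x - c x) * ∏ l ∈ s, a l + c x * (∏ l ∈ s, a l - ∏ l ∈ s, c l) := by ring
    rw [e]
    refine (abs_add_le _ _).trans ?_
    rw [abs_mul, abs_mul]
    have h1 : |∏ l ∈ s, a l| ≤ 1 := by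
      rw [Finset.abs_prod]
      exact Finset.prod_le_one (fun _ _ => abs_nonneg _) fun l _ => ha l
    have h2 := mul_le_of_le_one_right (abs_nonneg (a x - c x)) h1
    have h3 := mul_le_of_le_one_left (abs_nonneg (∏ l ∈ s, a l - ∏ l ∈ s, c l)) (hc x)
    linarith

/-! ### The mean-field energy -/

section MeanField

variable {p K N : ℕ} {lam : Fin K → ℝ} {Θ : (Fin p → Fin K) → unitInterval}

lemma sum_comp_mul_prod (b : Fin N → Fin K) (θ : (Fin p → Fin K) → ℝ) (g : Fin N → ℝ) :
    ∑ i : Fin p → Fin N, θ (b ∘ i) * ∏ l, g (i l) =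
      ∑ j : Fin p → Fin K, θ j * ∏ l, ∑ v : Fin N with b v = j l, g v := by
  rw [← Finset.sum_fiberwise Finset.univ (fun i : Fin p → Fin N => b ∘ i)]
  refine Finset.sum_congr rfl fun j _ => ?_
  rw [Finset.prod_univ_sum, Finset.mul_sum]
  have hset : (Finset.univ.filter fun i : Fin p → Fin N => b ∘ i = j) =
      Fintype.piFinset fun l => Finset.univ.filter fun v => b v = j l := by
    ext i
    simp [Fintype.mem_piFinset, funext_iff]
  rw [← hset]
  refine Finset.sum_congr rfl fun i hi => ?_
  rw [(Finset.mem_filter.1 hi).2]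

lemma signSum_fiber (b : Fin N → Fin K) (x : Spins N) (j : Fin K) :
    signSum (fun v : {v // b v = j} => x v) = ∑ v : Fin N with b v = j, spin x v := by
  rw [signSum, Finset.sum_subtype (p := fun v => b v = j) _ (by simp) (spin x)]
  rfl

open Classical in
-- Admitting repeated indices makes the energy a polynomial in the block magnetizations; replacing
-- `n_j / N` by `λ_j` changes it by `O(1)`. Then `φ_{β'} ≤ 0` bounds it by entropy, with the factor
-- `β / β' < 1` that gives the exponential moment its room.
lemma mul_sum_injective_le (h0 : ∀ j, 0 ≤ lam j) (h1 : ∑ j, lam j = 1)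
    {b : Fin N → Fin K} (hb : ∀ v, v ∈ block lam N (b v)) (hp : 2 ≤ p) (hN : 0 < N) {β β' : ℝ}
    (hβ : 0 ≤ β) (hβ' : β < β')
    (hφ : ∀ t ∈ Set.Icc (0 : Fin K → ℝ) 1, meanFieldFn lam Θ β' t ≤ 0) (x : Spins N) :
    β / (N : ℝ) ^ (p - 1) * ∑ i : Fin p → Fin N with Function.Injective i,
      (Θ (b ∘ i) : ℝ) * ∏ l, spin x (i l) ≤
    ∑ j, β / β' * (Fintype.card {v // b v = j} *
      binEntropyI (signMean fun v : {v // b v = j} => x v)) +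
      (β * p ^ 2 + β * ((K : ℝ) ^ p * p) + β / β' * K) := by
  set t : Fin K → ℝ := fun j => signMean fun v : {v // b v = j} => x v
  set n : Fin K → ℝ := fun j => Fintype.card {v // b v = j}
  have hN' : (0 : ℝ) < N := by exact_mod_cast hN
  have hN1 : (0 : ℝ) < (N : ℝ) ^ (p - 1) := by positivity
  have hβ'0 : 0 < β' := hβ.trans_lt hβ'
  have ht : ∀ j, |t j| ≤ 1 := fun j => abs_signMean_le _
  have hl1 : ∀ j, lam j ≤ 1 := fun j => by
    rw [← h1]
    exact Finset.single_le_sum (fun i _ => h0 i) (Finset.mem_univ j)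
  have hn : ∀ j, |n j - N * lam j| ≤ 1 := fun j => by
    have := abs_card_block_sub_le h0 h1 hb j
    simpa only [n, Fintype.card_subtype] using this
  have hnN : ∀ j, n j ≤ N := fun j => by
    have := Fintype.card_subtype_le fun v => b v = j
    simp only [Fintype.card_fin] at this
    exact Nat.cast_le.2 this
  have hn0 : ∀ j, 0 ≤ n j := fun j => Nat.cast_nonneg _
  have hθ0 : ∀ j, (0 : ℝ) ≤ Θ j := fun j => (Θ j).2.1
  have hθ1 : ∀ j, (Θ j : ℝ) ≤ 1 := fun j => (Θ j).2.2
  -- tuples with repetitions contribute a bounded amount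
  have hinj : ∑ i : Fin p → Fin N with Function.Injective i,
      (Θ (b ∘ i) : ℝ) * ∏ l, spin x (i l) ≤
      (∑ i : Fin p → Fin N, (Θ (b ∘ i) : ℝ) * ∏ l, spin x (i l)) + p ^ 2 * (N : ℝ) ^ (p - 1) := by
    rw [← Finset.sum_filter_add_sum_filter_not Finset.univ (fun i => Function.Injective i)
      (fun i : Fin p → Fin N => (Θ (b ∘ i) : ℝ) * ∏ l, spin x (i l)), add_assoc]
    refine le_add_of_nonneg_right ?_
    rw [← neg_le_iff_add_nonneg', ← Finset.sum_neg_distrib]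
    refine (Finset.sum_le_card_nsmul _ _ 1 fun i _ => ?_).trans ?_
    · refine (neg_le_abs _).trans ?_
      rw [abs_mul, abs_prod_spin, mul_one, abs_of_nonneg (hθ0 _)]
      exact hθ1 _
    · rw [nsmul_eq_mul, mul_one]
      exact_mod_cast card_not_injective_le p N
  have hsum : ∑ i : Fin p → Fin N, (Θ (b ∘ i) : ℝ) * ∏ l, spin x (i l) =
      (N : ℝ) ^ (p - 1) * (N * ∑ j : Fin p → Fin K, (Θ j : ℝ) * ∏ l, (n (j l) / N * t (j l))) := by
    rw [sum_comp_mul_prod b (fun j => (Θ j : ℝ)) (spin x), ← mul_assoc, ← pow_succ,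
      Nat.sub_add_cancel (by omega), Finset.mul_sum]
    refine Finset.sum_congr rfl fun j _ => ?_
    have : ∀ l, ∑ v : Fin N with b v = j l, spin x v = N * (n (j l) / N * t (j l)) := fun l => by
      rw [← signSum_fiber, ← card_mul_signMean]
      field_simp
      rfl
    simp only [this]
    rw [Finset.prod_mul_distrib]
    simp only [Finset.prod_const, Finset.card_univ, Fintype.card_fin]
    ring
  have hprod : ∀ j : Fin p → Fin K, N * ((Θ j : ℝ) * ∏ l, (n (j l) / N * t (j l))) ≤
      N * ((Θ j : ℝ) * ∏ l, lam (j l) * |t (j l)|) + p := fun j => by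
    have d1 := abs_prod_sub_prod_le Finset.univ (fun l => n (j l) / N * t (j l))
      (fun l => lam (j l) * t (j l))
      (fun l => by
        rw [abs_mul, abs_of_nonneg (div_nonneg (hn0 _) hN'.le)]
        exact mul_le_one₀ ((div_le_one hN').2 (hnN _)) (abs_nonneg _) (ht _))
      (fun l => by
        rw [abs_mul, abs_of_nonneg (h0 _)]
        exact mul_le_one₀ (hl1 _) (abs_nonneg _) (ht _))
    have d2 : ∑ l : Fin p, |n (j l) / N * t (j l) - lam (j l) * t (j l)| ≤ p * (1 / N) := by
      refine (Finset.sum_le_card_nsmul _ _ (1 / (N : ℝ)) fun l _ => ?_).trans ?_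
      · have e : n (j l) / N * t (j l) - lam (j l) * t (j l) =
            (n (j l) - N * lam (j l)) / N * t (j l) := by field_simp
        rw [e, abs_mul, abs_div, Nat.abs_cast]
        refine (mul_le_of_le_one_right (by positivity) (ht _)).trans ?_
        exact div_le_div_of_nonneg_right (hn _) hN'.le
      · simp
    -- The hypothesis on `φ` covers only the nonnegative cube. Passing to `|t|` can only raise the
    -- energy, since `Θ` and `lam` are nonnegative, and leaves the even entropy unchanged.
    have d3 : ∏ l, lam (j l) * t (j l) ≤ ∏ l, lam (j l) * |t (j l)| := by
      refine (le_abs_self _).trans (le_of_eq ?_)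
      rw [Finset.abs_prod]
      exact Finset.prod_congr rfl fun l _ => by rw [abs_mul, abs_of_nonneg (h0 _)]
    have d4 : ∏ l, (n (j l) / N * t (j l)) ≤ ∏ l, lam (j l) * |t (j l)| + p * (1 / N) := by
      linarith [(abs_le.1 (d1.trans d2)).2]
    have d5 := mul_le_mul_of_nonneg_left d4 (hθ0 j)
    have d6 : (Θ j : ℝ) * (p * (1 / N)) ≤ p * (1 / N) :=
      mul_le_of_le_one_left (by positivity) (hθ1 j)
    have d7 : (Θ j : ℝ) * ∏ l, (n (j l) / N * t (j l)) ≤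
        (Θ j : ℝ) * ∏ l, lam (j l) * |t (j l)| + p * (1 / N) := by linarith
    have d8 := mul_le_mul_of_nonneg_left d7 hN'.le
    have d9 : (N : ℝ) * (p * (1 / N)) = p := by field_simp
    linarith
  have hprod2 : N * ∑ j : Fin p → Fin K, (Θ j : ℝ) * ∏ l, (n (j l) / N * t (j l)) ≤
      N * (∑ j : Fin p → Fin K, (Θ j : ℝ) * ∏ l, lam (j l) * |t (j l)|) + (K : ℝ) ^ p * p := by
    rw [Finset.mul_sum, Finset.mul_sum]
    refine (Finset.sum_le_sum fun j _ => hprod j).trans (le_of_eq ?_)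
    rw [Finset.sum_add_distrib]
    simp [Finset.card_univ, Fintype.card_pi]
  have hent : β' * (∑ j : Fin p → Fin K, (Θ j : ℝ) * ∏ l, lam (j l) * |t (j l)|) ≤
      ∑ j, lam j * binEntropyI (t j) := by
    have := hφ (fun j => |t j|) ⟨fun j => abs_nonneg _, fun j => ht j⟩
    simp only [meanFieldFn, binEntropyI_abs] at this
    linarith
  have hent2 : N * ∑ j, lam j * binEntropyI (t j) ≤ (∑ j, n j * binEntropyI (t j)) + K := by
    rw [Finset.mul_sum]
    have : ∀ j, N * (lam j * binEntropyI (t j)) ≤ n j * binEntropyI (t j) + 1 := fun j => by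
      have e1 := binEntropyI_nonneg (ht j)
      have e2 := binEntropyI_le_one (ht j)
      have e3 := (abs_le.1 (hn j)).1
      nlinarith
    refine (Finset.sum_le_sum fun j _ => this j).trans (le_of_eq ?_)
    rw [Finset.sum_add_distrib]
    simp
  have hγ : 0 ≤ β / β' := by positivity
  have hinj2 := mul_le_mul_of_nonneg_left hinj (show 0 ≤ β / (N : ℝ) ^ (p - 1) by positivity)
  rw [hsum] at hinj2
  have e1 : ∀ X : ℝ, β / (N : ℝ) ^ (p - 1) * ((N : ℝ) ^ (p - 1) * X +
      p ^ 2 * (N : ℝ) ^ (p - 1)) = β * X + β * p ^ 2 := fun X => by field_simp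
  rw [e1] at hinj2
  have e2 := mul_le_mul_of_nonneg_left hprod2 hβ
  have e3 := mul_le_mul_of_nonneg_left hent (mul_nonneg hγ hN'.le)
  have e4 := mul_le_mul_of_nonneg_left hent2 hγ
  have e5 : ∀ X : ℝ, β / β' * N * (β' * X) = β * (N * X) := fun X => by field_simp
  rw [e5] at e3
  rw [← Finset.mul_sum]
  change _ ≤ β / β' * ∑ j, n j * binEntropyI (t j) + _
  rw [mul_add] at e2 e4
  linarith

end MeanField

/-! ### The threshold -/

section Threshold

variable {p K : ℕ} {lam : Fin K → ℝ} {Θ : (Fin p → Fin K) → unitInterval}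

lemma meanFieldFn_zero (hp : p ≠ 0) (β : ℝ) : meanFieldFn lam Θ β 0 = 0 := by
  simp [meanFieldFn, binEntropyI_zero, hp]

lemma exists_meanFieldFn_nonpos {β : ℝ} (hβ : (β : EReal) < hsbmThreshold lam Θ) :
    ∃ β' : ℝ, β < β' ∧ ∀ t ∈ Set.Icc (0 : Fin K → ℝ) 1, meanFieldFn lam Θ β' t ≤ 0 := by
  obtain ⟨_, ⟨β', ⟨_, hlub⟩, rfl⟩, hlt⟩ := lt_sSup_iff.1 hβ
  -- Any element of the set beyond `β` serves, so no monotonicity of the condition in `β` is needed.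
  exact ⟨β', EReal.coe_lt_coe_iff.1 hlt, fun t ht => hlub.1 ⟨t, ht, rfl⟩⟩

lemma pos_of_hsbmThreshold_lt (hp : p ≠ 0) (h0 : ∀ j, 0 ≤ lam j) {β : ℝ}
    (hβ : hsbmThreshold lam Θ < (β : EReal)) : 0 < β := by
  have h : ((0 : ℝ) : EReal) ≤ hsbmThreshold lam Θ := by
    refine le_sSup ⟨0, ⟨le_rfl, ?_, ?_⟩, rfl⟩
    · rintro _ ⟨t, ht, rfl⟩
      simp only [meanFieldFn, zero_mul, zero_sub, neg_nonpos]
      refine Finset.sum_nonneg fun j _ => mul_nonneg (h0 j) (binEntropyI_nonneg ?_)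
      rw [abs_of_nonneg (ht.1 j)]
      exact ht.2 j
    · intro c hc
      exact hc ⟨0, ⟨le_rfl, zero_le_one⟩, meanFieldFn_zero hp 0⟩
  exact EReal.coe_lt_coe_iff.1 (h.trans_lt hβ)

lemma continuous_meanFieldFn (β : ℝ) : Continuous (meanFieldFn lam Θ β) := by
  unfold meanFieldFn
  have h : ∀ j : Fin K, Continuous fun t : Fin K → ℝ => binEntropyI (t j) := fun j =>
    continuous_binEntropyI.comp (continuous_apply j)
  fun_prop

lemma exists_meanFieldFn_pos (hp : p ≠ 0) (h0 : ∀ j, 0 ≤ lam j) {β : ℝ}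
    (hβ : hsbmThreshold lam Θ < (β : EReal)) :
    ∃ t : Fin K → ℝ, (∀ j, 0 ≤ t j) ∧ (∀ j, t j < 1) ∧ 0 < meanFieldFn lam Θ β t := by
  have hβ0 := pos_of_hsbmThreshold_lt hp h0 hβ
  obtain ⟨t, ht, hpos⟩ : ∃ t ∈ Set.Icc (0 : Fin K → ℝ) 1, 0 < meanFieldFn lam Θ β t := by
    by_contra! hcon
    refine absurd hβ (not_lt.2 (le_sSup ⟨β, ⟨hβ0.le, ?_, ?_⟩, rfl⟩))
    · rintro _ ⟨t, ht, rfl⟩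
      exact hcon t ht
    · intro c hc
      exact hc ⟨0, ⟨le_rfl, zero_le_one⟩, meanFieldFn_zero hp β⟩
  -- Shrinking the maximizing direction slightly keeps `φ` positive and brings every coordinate
  -- below one, as strictly positive product weights require.
  have hcont : Continuous fun r : ℝ => meanFieldFn lam Θ β (r • t) :=
    (continuous_meanFieldFn β).comp (by fun_prop)
  have hev := ((hcont.tendsto 1).mono_left (nhdsWithin_le_nhds (s := Set.Iio 1))).eventually_const_lt
    (show 0 < meanFieldFn lam Θ β ((1 : ℝ) • t) by rwa [one_smul])
  obtain ⟨r, hr, hr2⟩ := (hev.and (Ioo_mem_nhdsLT (zero_lt_one (α := ℝ)))).exists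
  refine ⟨r • t, fun j => mul_nonneg hr2.1.le (ht.1 j), fun j => ?_, hr⟩
  have h1 : t j ≤ 1 := ht.2 j
  have h2 : 0 ≤ t j := ht.1 j
  simp only [Pi.smul_apply, smul_eq_mul]
  nlinarith [hr2.1, hr2.2]

end Threshold

/-! ### Below the threshold -/

section Below

variable {p K : ℕ} {lam : Fin K → ℝ} {Θ : (Fin p → Fin K) → unitInterval}

lemma hamiltonian_hsbmTensor {N : ℕ} (G : UniformHypergraph p N) (β : ℝ) (x : Spins N) :
    β * hamiltonian (hsbmTensor G) x =
      β / (N : ℝ) ^ (p - 1) * ∑ i, adjTensor G i * ∏ l, spin x (i l) := by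
  rw [hamiltonian, Finset.mul_sum, Finset.mul_sum]
  exact Finset.sum_congr rfl fun i _ => by rw [hsbmTensor]; ring

/-- After averaging over the graph the weight of `x` is a product over blocks of functions of the
spins in that block, so the sum over spins factorizes into entropy moments, with one bounded factor
per block. -/
lemma exists_integral_partitionFn_le (hp : 2 ≤ p) (h0 : ∀ j, 0 ≤ lam j) (h1 : ∑ j, lam j = 1)
    (hΘ : ∀ (σ : Equiv.Perm (Fin p)) (j : Fin p → Fin K), Θ (j ∘ σ) = Θ j) {β : ℝ} (hβ : 0 ≤ β)
    (hβ' : (β : EReal) < hsbmThreshold lam Θ) :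
    ∃ C : ℝ, ∀ᶠ N : ℕ in atTop, ∫ G, partitionFn (hsbmTensor G) β ∂(hsbmLaw lam Θ N) ≤ C := by
  classical
  obtain ⟨β', hlt, hφ⟩ := exists_meanFieldFn_nonpos hβ'
  have hβ'0 : 0 < β' := hβ.trans_lt hlt
  set γ := β / β'
  have hγ0 : 0 ≤ γ := by positivity
  have hγ1 : γ < 1 := (div_lt_one hβ'0).2 hlt
  set A := Real.exp ((β * (p : ℝ) ^ p) ^ 2)
  set B := Real.exp (β * p ^ 2 + β * ((K : ℝ) ^ p * p) + γ * K)
  set D := 2 * Real.exp γ * (1 - Real.exp (-(1 - γ)))⁻¹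
  refine ⟨A * B * D ^ K, ?_⟩
  filter_upwards [eventually_gt_atTop 0,
    tendsto_natCast_atTop_atTop.eventually_ge_atTop (β * (p : ℝ) ^ p)] with N hN hβN
  choose b hb using fun v : Fin N => exists_mem_block h1 v
  have hx : ∀ x : Spins N, ∫ G, Real.exp (β * hamiltonian (hsbmTensor G) x) ∂(hsbmLaw lam Θ N) ≤
      A * B * ∏ j, Real.exp (γ * (Fintype.card {v // b v = j} *
        binEntropyI (signMean fun v : {v // b v = j} => x v))) := fun x => by
    simp only [hamiltonian_hsbmTensor]
    refine (integral_exp_adjTensor_le hp h0 hΘ hb hβ hN hβN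
      fun i => (abs_prod_spin x Finset.univ i).le).trans ?_
    rw [mul_assoc]
    refine mul_le_mul_of_nonneg_left ?_ (Real.exp_pos _).le
    rw [← Real.exp_sum, ← Real.exp_add, Real.exp_le_exp, add_comm _ (∑ j, _)]
    exact mul_sum_injective_le h0 h1 hb hp hN hβ hlt hφ x
  simp only [partitionFn]
  rw [integral_div, integral_finsetSum _ fun x _ => Integrable.of_finite,
    div_le_iff₀ (by positivity)]
  refine (Finset.sum_le_sum fun x _ => hx x).trans ?_
  rw [← Finset.mul_sum, mul_assoc _ (D ^ K)]
  refine mul_le_mul_of_nonneg_left ?_ (by positivity)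
  rw [sum_prod_fibers b fun j (y : {v // b v = j} → ℤˣ) =>
    Real.exp (γ * (Fintype.card {v // b v = j} * binEntropyI (signMean y)))]
  refine (Finset.prod_le_prod (fun j _ => by positivity)
    fun j _ => sum_exp_entropy_signMean_le (ι := {v // b v = j}) hγ0 hγ1).trans (le_of_eq ?_)
  rw [Finset.prod_mul_distrib, Finset.prod_pow_eq_pow_sum]
  have hcard : ∑ j, Fintype.card {v // b v = j} = N := by
    rw [← Fintype.card_sigma, Fintype.card_congr (Equiv.sigmaFiberEquiv b), Fintype.card_fin]
  rw [hcard]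
  simp [D, mul_comm]

lemma supp_hsbmTensor {N : ℕ} (G : UniformHypergraph p N) :
    ∀ i, ¬ Function.Injective i → hsbmTensor G i = 0 :=
  (isMeanFieldTensor_hsbmTensor G).supp

lemma isBigO_integral_logPartitionFn (hp : 2 ≤ p) (h0 : ∀ j, 0 ≤ lam j) (h1 : ∑ j, lam j = 1)
    (hΘ : ∀ (σ : Equiv.Perm (Fin p)) (j : Fin p → Fin K), Θ (j ∘ σ) = Θ j) {β : ℝ} (hβ : 0 ≤ β)
    (hβ' : (β : EReal) < hsbmThreshold lam Θ) :
    (fun N : ℕ => ∫ H, logPartitionFn (hsbmTensor H) β ∂(hsbmLaw lam Θ N))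
      =O[atTop] (fun _ => (1 : ℝ)) := by
  obtain ⟨C, hC⟩ := exists_integral_partitionFn_le hp h0 h1 hΘ hβ hβ'
  refine Asymptotics.IsBigO.of_bound C ?_
  filter_upwards [hC] with N hN
  have hnn : 0 ≤ ∫ H, logPartitionFn (hsbmTensor H) β ∂(hsbmLaw lam Θ N) :=
    integral_nonneg fun H => logPartitionFn_nonneg (by omega) (supp_hsbmTensor H) β
  rw [Real.norm_of_nonneg hnn, norm_one, mul_one]
  refine le_trans (integral_mono Integrable.of_finite Integrable.of_finite fun H => ?_) hN
  have := Real.log_le_sub_one_of_pos (partitionFn_pos (hsbmTensor H) β)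
  simp only [logPartitionFn]
  linarith

/-- Estimates within a third of the distance of two parameters separate them. -/
lemma isingProb_withinDist_le {N : ℕ} (J : Tensor p N) (e : Spins N → EReal) {β₁ β₂ : ℝ}
    (h : β₁ < β₂) :
    isingProb J β₂ {x | WithinDist (e x) β₁ ((β₂ - β₁) / 3)} ≤
      1 - isingProb J β₂ {x | WithinDist (e x) β₂ ((β₂ - β₁) / 3)} := by
  rw [← isingProb_compl]
  refine isingProb_mono J β₂ ?_
  rintro x ⟨b, hb, hb1⟩ ⟨c, hc, hc1⟩
  rw [hb, EReal.coe_eq_coe_iff] at hc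
  subst hc
  have := abs_le.1 hb1
  have := abs_le.1 hc1
  linarith

/-- The event that the estimate is near `β₁` has vanishing probability at `β₂`; the comparison then
keeps its probability at `β₁` below 3/4. Boundedness for infinitely many `N` suffices, because
consistency concerns all large `N`. -/
lemma not_isConsistentAt (hp : p ≠ 0) {J : ∀ N, Tensor p N}
    (hJ : ∀ N i, ¬ Function.Injective i → J N i = 0) {β₁ β₂ C : ℝ} (h1 : 0 ≤ β₁) (h12 : β₁ < β₂)
    (hC : ∃ᶠ N in atTop, partitionFn (J N) β₂ ≤ C) (est : ∀ N, Spins N → EReal)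
    (hc1 : IsConsistentAt J est β₁) (hc2 : IsConsistentAt J est β₂) : False := by
  have h2 : 0 < β₂ := h1.trans_lt h12
  have hC0 : 0 < C := by
    obtain ⟨N, hN⟩ := hC.exists
    exact (partitionFn_pos _ _).trans_le hN
  set r := (β₂ - β₁) / 3
  have hr : 0 < r := by simp only [r]; linarith
  -- Makes the low-energy term of the comparison equal to 1/4; the tolerance `1 / (4 * (C * E))`
  -- does the same for the other term.
  set M := 4 * C / β₂
  have hM : 0 < M := by positivity
  set E := Real.exp ((β₂ - β₁) * M)
  have hE : 0 < E := Real.exp_pos _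
  have e1 := (hc1 r hr).eventually_const_lt (show (3 / 4 : ℝ) < 1 by norm_num)
  have e2 := (hc2 r hr).eventually_const_lt (show 1 - 1 / (4 * (C * E)) < 1 by
    have : 0 < 1 / (4 * (C * E)) := by positivity
    linarith)
  obtain ⟨N, hZ, hN1, hN2⟩ := (hC.and_eventually (e1.and e2)).exists
  have h3 := isingProb_le hp (hJ N) h1 h12 hM {x | WithinDist (est N x) β₁ r}
  have h4 := isingProb_withinDist_le (J N) (est N) h12
  set P := isingProb (J N) β₂ {x | WithinDist (est N x) β₁ r}
  have hP0 : 0 ≤ P := isingProb_nonneg _ _ _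
  have hP : P ≤ 1 / (4 * (C * E)) := by linarith
  have h5 : partitionFn (J N) β₂ * (E * P + 1 / (β₂ * M)) ≤ C * (E * P + 1 / (β₂ * M)) := by
    gcongr
  have h6 : C * (E * P) ≤ 1 / 4 := by
    have := mul_le_mul_of_nonneg_left hP (show 0 ≤ C * E by positivity)
    have e : C * E * (1 / (4 * (C * E))) = 1 / 4 := by field_simp
    linarith
  have h7 : C * (1 / (β₂ * M)) = 1 / 4 := by simp only [M]; field_simp
  rw [mul_add] at h5
  linarith

/-- By Fatou the lower limit of `Z_N` has finite mean, hence is finite almost everywhere. Only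
marginal laws enter, so the coupling of the graphs is irrelevant. -/
lemma ae_frequently_partitionFn_le (hp : 2 ≤ p) (h0 : ∀ j, 0 ≤ lam j) (h1 : ∑ j, lam j = 1)
    (hΘ : ∀ (σ : Equiv.Perm (Fin p)) (j : Fin p → Fin K), Θ (j ∘ σ) = Θ j)
    {Ω : Type*} [MeasurableSpace Ω] {μ : Measure Ω}
    {G : ∀ N : ℕ, Ω → UniformHypergraph p N} (hG : ∀ N, HasLaw (G N) (hsbmLaw lam Θ N) μ)
    {β : ℝ} (hβ : 0 ≤ β) (hβ' : (β : EReal) < hsbmThreshold lam Θ) :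
    ∀ᵐ ω ∂μ, ∃ C : ℝ, ∃ᶠ N in atTop, partitionFn (hsbmTensor (G N ω)) β ≤ C := by
  obtain ⟨C, hC⟩ := exists_integral_partitionFn_le hp h0 h1 hΘ hβ hβ'
  have hmeas : ∀ N, Measurable fun H : UniformHypergraph p N =>
      ENNReal.ofReal (partitionFn (hsbmTensor H) β) := fun N => measurable_of_finite _
  have hF := lintegral_liminf_le' (u := atTop) (μ := μ)
    (f := fun N ω => ENNReal.ofReal (partitionFn (hsbmTensor (G N ω)) β))
    fun N => (hmeas N).comp_aemeasurable (hG N).aemeasurable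
  have hint : ∀ᶠ N in atTop,
      ∫⁻ ω, ENNReal.ofReal (partitionFn (hsbmTensor (G N ω)) β) ∂μ ≤ ENNReal.ofReal C := by
    filter_upwards [hC] with N hN
    have h := (hG N).lintegral_comp (hmeas N).aemeasurable
    rw [h, ← ofReal_integral_eq_lintegral_ofReal Integrable.of_finite
      (Eventually.of_forall fun H => (partitionFn_pos _ _).le)]
    exact ENNReal.ofReal_le_ofReal hN
  have hlt := (hF.trans (liminf_le_of_frequently_le' hint.frequently)).trans_lt
    ENNReal.ofReal_lt_top
  have hm : ∀ N, AEMeasurable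
      (fun ω => ENNReal.ofReal (partitionFn (hsbmTensor (G N ω)) β)) μ :=
    fun N => (hmeas N).comp_aemeasurable (hG N).aemeasurable
  have hliminf : AEMeasurable (fun ω =>
      liminf (fun N => ENNReal.ofReal (partitionFn (hsbmTensor (G N ω)) β)) atTop) μ := by
    refine ⟨fun ω => liminf (fun N => (hm N).mk _ ω) atTop,
      Measurable.liminf fun N => (hm N).measurable_mk, ?_⟩
    filter_upwards [ae_all_iff.2 fun N => (hm N).ae_eq_mk] with ω h
    simp only [h]
  have hae := ae_lt_top' hliminf hlt.ne
  filter_upwards [hae] with ω hω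
  obtain ⟨c, hc, -⟩ := ENNReal.lt_iff_exists_nnreal_btwn.1 hω
  refine ⟨c, (frequently_lt_of_liminf_lt (by isBoundedDefault) hc).mono fun N hN => ?_⟩
  exact (ENNReal.ofReal_le_iff_le_toReal ENNReal.coe_ne_top).1 hN.le

lemma ae_not_isConsistentAt (hp : 2 ≤ p) (h0 : ∀ j, 0 ≤ lam j) (h1 : ∑ j, lam j = 1)
    (hΘ : ∀ (σ : Equiv.Perm (Fin p)) (j : Fin p → Fin K), Θ (j ∘ σ) = Θ j)
    {Ω : Type*} [MeasurableSpace Ω] {μ : Measure Ω}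
    {G : ∀ N : ℕ, Ω → UniformHypergraph p N} (hG : ∀ N, HasLaw (G N) (hsbmLaw lam Θ N) μ) :
    ∀ᵐ ω ∂μ, ∀ β₁ β₂ : ℝ, 0 ≤ β₁ → β₁ < β₂ → (β₂ : EReal) < hsbmThreshold lam Θ →
      ¬ ∃ est : ∀ N, Spins N → EReal,
        IsConsistentAt (fun N => hsbmTensor (G N ω)) est β₁ ∧
        IsConsistentAt (fun N => hsbmTensor (G N ω)) est β₂ := by
  -- Rational parameters leave a single null set that serves all real pairs at once.
  have hall : ∀ᵐ ω ∂μ, ∀ q : ℚ, 0 ≤ (q : ℝ) → ((q : ℝ) : EReal) < hsbmThreshold lam Θ →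
      ∃ C : ℝ, ∃ᶠ N in atTop, partitionFn (hsbmTensor (G N ω)) (q : ℝ) ≤ C := by
    refine ae_all_iff.2 fun q => ?_
    by_cases hq : 0 ≤ (q : ℝ) ∧ ((q : ℝ) : EReal) < hsbmThreshold lam Θ
    · filter_upwards [ae_frequently_partitionFn_le hp h0 h1 hΘ hG hq.1 hq.2] with ω hω _ _
      exact hω
    · exact Eventually.of_forall fun ω ha hb => absurd ⟨ha, hb⟩ hq
  filter_upwards [hall] with ω hω β₁ β₂ hβ₁ h12 hβ₂
  rintro ⟨est, hc1, hc2⟩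
  obtain ⟨q, hq1, hq2⟩ := EReal.lt_iff_exists_rat_btwn.1 hβ₂
  have hq1' : β₂ < q := EReal.coe_lt_coe_iff.1 hq1
  obtain ⟨C, hC⟩ := hω q (by linarith) hq2
  refine not_isConsistentAt (C := 1 + C) (by omega) (fun N => supp_hsbmTensor (G N ω)) hβ₁ h12
    (hC.mono fun N hN => ?_) est hc1 hc2
  have := partitionFn_le_one_add (hsbmTensor (G N ω)) (by linarith : 0 ≤ β₂) hq1'.le
  linarith

lemma not_isJointlyConsistentAt (hp : 2 ≤ p) (h0 : ∀ j, 0 ≤ lam j) (h1 : ∑ j, lam j = 1)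
    (hΘ : ∀ (σ : Equiv.Perm (Fin p)) (j : Fin p → Fin K), Θ (j ∘ σ) = Θ j)
    {β₁ β₂ : ℝ} (hβ₁ : 0 ≤ β₁) (h12 : β₁ < β₂) (hβ₂ : (β₂ : EReal) < hsbmThreshold lam Θ)
    (est : ∀ N, UniformHypergraph p N → Spins N → EReal)
    (hc1 : IsJointlyConsistentAt lam Θ est β₁) (hc2 : IsJointlyConsistentAt lam Θ est β₂) :
    False := by
  have h2 : 0 < β₂ := hβ₁.trans_lt h12
  obtain ⟨C₀, hC₀⟩ := exists_integral_partitionFn_le hp h0 h1 hΘ h2.le hβ₂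
  set C := max C₀ 1
  have hC0 : 0 < C := lt_of_lt_of_le one_pos (le_max_right _ _)
  set r := (β₂ - β₁) / 3
  have hr : 0 < r := by simp only [r]; linarith
  -- By Markov's inequality, graphs with `Z_N > L` have probability at most 1/4; on the others the
  -- comparison applies with the constant `L`.
  set L := 4 * C
  have hL : 0 < L := by positivity
  set M := 4 * L / β₂
  have hM : 0 < M := by positivity
  set E := Real.exp ((β₂ - β₁) * M)
  have hE : 0 < E := Real.exp_pos _
  have e1 := (hc1 r hr).eventually_const_lt (show (3 / 4 : ℝ) < 1 by norm_num)
  have e2 := (hc2 r hr).eventually_const_lt (show 1 - 1 / (4 * (L * E)) < 1 by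
    have : 0 < 1 / (4 * (L * E)) := by positivity
    linarith)
  obtain ⟨N, hN1, hN2, hZ⟩ := (e1.and (e2.and hC₀)).exists
  set P₁ : UniformHypergraph p N → ℝ := fun G =>
    isingProb (hsbmTensor G) β₁ {x | WithinDist (est N G x) β₁ r}
  set P₂ : UniformHypergraph p N → ℝ := fun G =>
    isingProb (hsbmTensor G) β₂ {x | WithinDist (est N G x) β₁ r}
  set Q₂ : UniformHypergraph p N → ℝ := fun G =>
    isingProb (hsbmTensor G) β₂ {x | WithinDist (est N G x) β₂ r}
  set Z : UniformHypergraph p N → ℝ := fun G => partitionFn (hsbmTensor G) β₂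
  have hpt : ∀ G, P₁ G ≤ (Z G * (1 / L) + L * E * P₂ G) + L * (1 / (β₂ * M)) := fun G => by
    have hP2 : 0 ≤ P₂ G := isingProb_nonneg _ _ _
    have hZ0 : 0 < Z G := partitionFn_pos _ _
    have hc : 0 < 1 / (β₂ * M) := by positivity
    have hZL : 0 ≤ Z G * (1 / L) := by positivity
    rcases le_total (Z G) L with hle | hle
    · have h3 := isingProb_le (by omega) (supp_hsbmTensor G) hβ₁ h12 hM
        {x | WithinDist (est N G x) β₁ r}
      have h5 : Z G * (E * P₂ G + 1 / (β₂ * M)) ≤ L * (E * P₂ G + 1 / (β₂ * M)) := by gcongr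
      have h6 : P₁ G ≤ Z G * (E * P₂ G + 1 / (β₂ * M)) := h3
      rw [mul_add L] at h5
      linarith
    · have h3 : P₁ G ≤ 1 := isingProb_le_one _ _ _
      have h4 : 1 ≤ Z G * (1 / L) := by
        rw [mul_one_div, le_div_iff₀ hL]; linarith
      have h5 : 0 ≤ L * E * P₂ G := by positivity
      have h6 : 0 ≤ L * (1 / (β₂ * M)) := by positivity
      linarith
  have hint1 : ∫ G, P₁ G ∂(hsbmLaw lam Θ N) ≤
      (∫ G, Z G ∂(hsbmLaw lam Θ N)) * (1 / L) + L * E * (∫ G, P₂ G ∂(hsbmLaw lam Θ N)) +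
        L * (1 / (β₂ * M)) := by
    refine (integral_mono Integrable.of_finite Integrable.of_finite hpt).trans (le_of_eq ?_)
    rw [integral_add Integrable.of_finite Integrable.of_finite,
      integral_add Integrable.of_finite Integrable.of_finite, integral_mul_const,
      integral_const_mul, integral_const]
    simp
  have hint2 : ∫ G, P₂ G ∂(hsbmLaw lam Θ N) ≤ 1 - ∫ G, Q₂ G ∂(hsbmLaw lam Θ N) := by
    have h3 : ∫ G, P₂ G ∂(hsbmLaw lam Θ N) ≤ ∫ G, (1 - Q₂ G) ∂(hsbmLaw lam Θ N) :=
      integral_mono Integrable.of_finite Integrable.of_finite fun G =>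
        isingProb_withinDist_le (hsbmTensor G) (est N G) h12
    refine h3.trans (le_of_eq ?_)
    rw [integral_sub Integrable.of_finite Integrable.of_finite, integral_const]
    simp
  have h6 : L * E * (∫ G, P₂ G ∂(hsbmLaw lam Θ N)) ≤ 1 / 4 := by
    have := mul_le_mul_of_nonneg_left (show ∫ G, P₂ G ∂(hsbmLaw lam Θ N) ≤ 1 / (4 * (L * E)) by
      linarith) (show 0 ≤ L * E by positivity)
    have e : L * E * (1 / (4 * (L * E))) = 1 / 4 := by field_simp
    linarith
  have h7 : L * (1 / (β₂ * M)) = 1 / 4 := by simp only [M]; field_simp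
  have h8 : (∫ G, Z G ∂(hsbmLaw lam Θ N)) * (1 / L) ≤ 1 / 4 := by
    have h9 : ∫ G, Z G ∂(hsbmLaw lam Θ N) ≤ C := hZ.trans (le_max_left _ _)
    have e : C * (1 / L) = 1 / 4 := by simp only [L]; field_simp
    rw [← e]
    gcongr
  linarith

end Below

/-! ### Above the threshold -/

section Above

variable {p K : ℕ} {lam : Fin K → ℝ} {Θ : (Fin p → Fin K) → unitInterval}

/-- All tuples with the given labels number `∏ n_{j_l}`; the rounding of block sizes costs the `p`
and the non-injective tuples cost the `p ^ 2`. -/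
lemma le_card_injective_labels {N : ℕ} (h0 : ∀ j, 0 ≤ lam j) (h1 : ∑ j, lam j = 1)
    {b : Fin N → Fin K} (hb : ∀ v, v ∈ block lam N (b v)) (hp : 2 ≤ p) (hN : 0 < N)
    (j : Fin p → Fin K) :
    (N : ℝ) ^ (p - 1) * (N * ∏ l, lam (j l) - (p + p ^ 2)) ≤
      ((Finset.univ.filter fun i : Fin p → Fin N => b ∘ i = j ∧ Function.Injective i).card : ℝ) := by
  classical
  have hN' : (0 : ℝ) < N := by exact_mod_cast hN
  have hl1 : ∀ j, lam j ≤ 1 := fun j => by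
    rw [← h1]
    exact Finset.single_le_sum (fun i _ => h0 i) (Finset.mem_univ j)
  set n : Fin K → ℝ := fun j => ((Finset.univ.filter fun v => b v = j).card : ℝ)
  have hn0 : ∀ j, 0 ≤ n j := fun j => Nat.cast_nonneg _
  have hnN : ∀ j, n j ≤ N := fun j => by
    have := Finset.card_filter_le (Finset.univ : Finset (Fin N)) fun v => b v = j
    rw [Finset.card_univ, Fintype.card_fin] at this
    exact Nat.cast_le.2 this
  have hall : ((Finset.univ.filter fun i : Fin p → Fin N => b ∘ i = j).card : ℝ) =
      ∏ l, n (j l) := by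
    have hset : (Finset.univ.filter fun i : Fin p → Fin N => b ∘ i = j) =
        Fintype.piFinset fun l => Finset.univ.filter fun v => b v = j l := by
      ext i
      simp [Fintype.mem_piFinset, funext_iff]
    rw [hset, Fintype.card_piFinset]
    push_cast
    rfl
  have hsplit : (Finset.univ.filter fun i : Fin p → Fin N => b ∘ i = j) ⊆
      (Finset.univ.filter fun i : Fin p → Fin N => b ∘ i = j ∧ Function.Injective i) ∪
        (Finset.univ.filter fun i : Fin p → Fin N => ¬ Function.Injective i) := by
    intro i hi
    simp only [Finset.mem_union, Finset.mem_filter, Finset.mem_univ, true_and] at hi ⊢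
    tauto
  have hcard : (∏ l, n (j l)) ≤
      ((Finset.univ.filter fun i : Fin p → Fin N => b ∘ i = j ∧ Function.Injective i).card : ℝ) +
        p ^ 2 * (N : ℝ) ^ (p - 1) := by
    rw [← hall]
    have := (Finset.card_le_card hsplit).trans ((Finset.card_union_le _ _).trans
      (Nat.add_le_add_left (card_not_injective_le p N) _))
    exact_mod_cast this
  have d1 := abs_prod_sub_prod_le Finset.univ (fun l => n (j l) / N) (fun l => lam (j l))
    (fun l => by
      rw [abs_of_nonneg (div_nonneg (hn0 _) hN'.le)]
      exact (div_le_one hN').2 (hnN _))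
    (fun l => by rw [abs_of_nonneg (h0 _)]; exact hl1 _)
  have d2 : ∑ l : Fin p, |n (j l) / N - lam (j l)| ≤ p * (1 / N) := by
    refine (Finset.sum_le_card_nsmul _ _ (1 / (N : ℝ)) fun l _ => ?_).trans ?_
    · have e : n (j l) / N - lam (j l) = (n (j l) - N * lam (j l)) / N := by field_simp
      rw [e, abs_div, Nat.abs_cast]
      exact div_le_div_of_nonneg_right (abs_card_block_sub_le h0 h1 hb _) hN'.le
    · simp
  have d3 := (abs_le.1 (d1.trans d2)).1
  rw [Finset.prod_div_distrib] at d3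
  simp only [Finset.prod_const, Finset.card_univ, Fintype.card_fin] at d3
  have hNp : (N : ℝ) ^ p = (N : ℝ) ^ (p - 1) * N := by
    rw [← pow_succ, Nat.sub_add_cancel (by omega)]
  have d4 : (N : ℝ) ^ p * (∏ l, lam (j l) - p * (1 / N)) ≤ ∏ l, n (j l) := by
    have d5 : ∏ l, lam (j l) - p * (1 / N) ≤ (∏ l, n (j l)) / (N : ℝ) ^ p := by linarith
    rw [le_div_iff₀ (by positivity)] at d5
    linarith
  have e : (N : ℝ) ^ p * (∏ l, lam (j l) - p * (1 / N)) =
      (N : ℝ) ^ (p - 1) * (N * ∏ l, lam (j l) - p) := by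
    rw [hNp]; field_simp
  rw [e] at d4
  linarith

/-- The lower tail of the number of hyperedges between given blocks. -/
lemma exists_measure_sum_adjTensor_le (hp : 2 ≤ p) (h0 : ∀ j, 0 ≤ lam j) (h1 : ∑ j, lam j = 1)
    (hΘ : ∀ (σ : Equiv.Perm (Fin p)) (j : Fin p → Fin K), Θ (j ∘ σ) = Θ j)
    (j : Fin p → Fin K) (ε : ℝ) :
    ∃ C : ℝ, 0 ≤ C ∧ ∃ N₀ : ℕ, ∀ N ≥ N₀, ∀ b : Fin N → Fin K, (∀ v, v ∈ block lam N (b v)) →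
      (hsbmLaw lam Θ N).real {G | (∑ i : Fin p → Fin N with b ∘ i = j, adjTensor G i) ≤
        (N : ℝ) ^ (p - 1) * (N * ((Θ j : ℝ) * ∏ l, lam (j l) - ε))} ≤ C * Real.exp (-(ε * N)) := by
  classical
  refine ⟨Real.exp ((1 * (p : ℝ) ^ p) ^ 2) * Real.exp (p + p ^ 2), by positivity, p ^ p + 1,
    fun N hN b hb => ?_⟩
  have hNpos : 0 < N := by omega
  have hN' : (0 : ℝ) < N := by exact_mod_cast hNpos
  have hNp : (0 : ℝ) < (N : ℝ) ^ (p - 1) := by positivity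
  have hβN : 1 * (p : ℝ) ^ p ≤ N := by
    rw [one_mul]; exact_mod_cast (by omega : p ^ p ≤ N)
  set θ : ℝ := (Θ j : ℝ)
  have hθ0 : 0 ≤ θ := (Θ j).2.1
  have hθ1 : θ ≤ 1 := (Θ j).2.2
  -- The negative sign makes the exponential moment bound, at parameter one, control the lower tail.
  set f : (Fin p → Fin N) → ℝ := fun i => if b ∘ i = j then -1 else 0
  have hf : ∀ i, |f i| ≤ 1 := fun i => by
    simp only [f]; split_ifs <;> simp
  have hmom := integral_exp_adjTensor_le hp h0 hΘ hb zero_le_one hNpos hβN hf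
  have hmean : 1 / (N : ℝ) ^ (p - 1) *
      ∑ i : Fin p → Fin N with Function.Injective i, (Θ (b ∘ i) : ℝ) * f i ≤
      -(θ * (N * ∏ l, lam (j l))) + (p + p ^ 2) := by
    have h2 : ∑ i : Fin p → Fin N with Function.Injective i, (Θ (b ∘ i) : ℝ) * f i =
        -(θ * ((Finset.univ.filter fun i : Fin p → Fin N =>
          b ∘ i = j ∧ Function.Injective i).card : ℝ)) := by
      rw [Finset.card_filter, Nat.cast_sum, Finset.mul_sum, ← Finset.sum_neg_distrib,
        Finset.sum_filter]
      refine Finset.sum_congr rfl fun i _ => ?_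
      by_cases hi : Function.Injective i <;> by_cases hj : b ∘ i = j <;> simp [f, hi, hj, θ]
    rw [h2, one_div, inv_mul_le_iff₀ hNp]
    have h3 := mul_le_mul_of_nonneg_left (le_card_injective_labels h0 h1 hb hp hNpos j) hθ0
    have h4 : θ * ((N : ℝ) ^ (p - 1) * (p + p ^ 2)) ≤ (N : ℝ) ^ (p - 1) * (p + p ^ 2) :=
      mul_le_of_le_one_left (by positivity) hθ1
    linarith
  have hmom2 := hmom.trans (mul_le_mul_of_nonneg_left (Real.exp_le_exp.2 hmean)
    (Real.exp_pos _).le)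
  set g : UniformHypergraph p N → ℝ := fun G =>
    Real.exp (1 / (N : ℝ) ^ (p - 1) * ∑ i, adjTensor G i * f i)
  set c := Real.exp (-(N * (θ * ∏ l, lam (j l) - ε)))
  have hsub : {G : UniformHypergraph p N |
      (∑ i : Fin p → Fin N with b ∘ i = j, adjTensor G i) ≤
        (N : ℝ) ^ (p - 1) * (N * (θ * ∏ l, lam (j l) - ε))} ⊆ {G | c ≤ g G} := by
    intro G hG
    rw [Set.mem_ofPred_eq] at hG ⊢
    have h2 : ∑ i, adjTensor G i * f i =
        -(∑ i : Fin p → Fin N with b ∘ i = j, adjTensor G i) := by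
      rw [Finset.sum_filter, ← Finset.sum_neg_distrib]
      refine Finset.sum_congr rfl fun i _ => ?_
      by_cases hj : b ∘ i = j <;> simp [f, hj]
    simp only [c, g]
    rw [Real.exp_le_exp, h2, one_div, le_inv_mul_iff₀ hNp]
    linarith
  have hmk := mul_meas_ge_le_integral_of_nonneg (μ := hsbmLaw lam Θ N) (f := g)
    (Eventually.of_forall fun G => (Real.exp_pos _).le) Integrable.of_finite c
  have hmono := measureReal_mono (μ := hsbmLaw lam Θ N) hsub
  have hc : 0 < c := Real.exp_pos _
  refine hmono.trans ?_
  refine le_of_mul_le_mul_left (hmk.trans (hmom2.trans (le_of_eq ?_))) hc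
  simp only [c]
  simp only [← Real.exp_add]
  ring_nf

lemma ae_eventually_sum_adjTensor (hp : 2 ≤ p) (h0 : ∀ j, 0 ≤ lam j) (h1 : ∑ j, lam j = 1)
    (hΘ : ∀ (σ : Equiv.Perm (Fin p)) (j : Fin p → Fin K), Θ (j ∘ σ) = Θ j)
    {Ω : Type*} [MeasurableSpace Ω] {μ : Measure Ω}
    {G : ∀ N : ℕ, Ω → UniformHypergraph p N} (hG : ∀ N, HasLaw (G N) (hsbmLaw lam Θ N) μ)
    {b : ∀ N, Fin N → Fin K} (hb : ∀ N v, v ∈ block lam N (b N v)) (j : Fin p → Fin K) {ε : ℝ}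
    (hε : 0 < ε) :
    ∀ᵐ ω ∂μ, ∀ᶠ N : ℕ in atTop, (N : ℝ) ^ (p - 1) * (N * ((Θ j : ℝ) * ∏ l, lam (j l) - ε)) ≤
      ∑ i : Fin p → Fin N with b N ∘ i = j, adjTensor (G N ω) i := by
  obtain ⟨C, hC0, N₀, hC⟩ := exists_measure_sum_adjTensor_le hp h0 h1 hΘ j ε
  set S : ∀ N : ℕ, Set (UniformHypergraph p N) := fun N =>
    {H | (∑ i : Fin p → Fin N with b N ∘ i = j, adjTensor H i) ≤
        (N : ℝ) ^ (p - 1) * (N * ((Θ j : ℝ) * ∏ l, lam (j l) - ε))}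
  -- Requiring `N₀ ≤ N` empties the first events, so the geometric bound holds for every `N` and
  -- Borel–Cantelli applies without independence.
  set s : ℕ → Set Ω := fun N => {ω | N₀ ≤ N ∧ G N ω ∈ S N}
  have hs : ∀ N, μ (s N) ≤ ENNReal.ofReal (C * Real.exp (-ε) ^ N) := fun N => by
    by_cases hN : N₀ ≤ N
    · have h2 : μ (s N) = hsbmLaw lam Θ N (S N) := by
        have := (hG N).measure_eq (p := fun H => H ∈ S N) (Set.toFinite _).measurableSet
        simp only [s, hN, true_and]
        exact this
      rw [h2, ← ofReal_measureReal]
      refine ENNReal.ofReal_le_ofReal ((hC N hN (b N) (hb N)).trans (le_of_eq ?_))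
      rw [← Real.exp_nat_mul]
      ring_nf
    · have : s N = ∅ := by ext; simp [s, hN]
      simp [this]
  have hsum : ∑' N, μ (s N) ≠ ⊤ := by
    refine ne_top_of_le_ne_top ?_ (ENNReal.tsum_le_tsum hs)
    refine Summable.tsum_ofReal_ne_top ?_
    refine (summable_geometric_of_lt_one (Real.exp_pos _).le ?_).mul_left C
    rw [← Real.exp_zero]; exact Real.exp_lt_exp.2 (by linarith)
  filter_upwards [ae_eventually_notMem hsum] with ω hω
  filter_upwards [hω, eventually_ge_atTop N₀] with N hN hN₀
  by_contra hcon
  exact hN ⟨hN₀, (not_le.1 hcon).le⟩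

/-- Linear growth of the log-partition function when the block densities have their limits. -/
lemma eventually_le_logPartitionFn (h0 : ∀ j, 0 ≤ lam j) (h1 : ∑ j, lam j = 1)
    {b : ∀ N, Fin N → Fin K} (hb : ∀ N v, v ∈ block lam N (b N v))
    (H : ∀ N, UniformHypergraph p N)
    (hH : ∀ (j : Fin p → Fin K) (m : ℕ), ∀ᶠ N : ℕ in atTop,
      (N : ℝ) ^ (p - 1) * (N * ((Θ j : ℝ) * ∏ l, lam (j l) - 1 / ((m : ℝ) + 1))) ≤
        ∑ i : Fin p → Fin N with b N ∘ i = j, adjTensor (H N) i)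
    {β : ℝ} (hβ : 0 ≤ β) {t : Fin K → ℝ} (ht0 : ∀ j, 0 ≤ t j) (ht1 : ∀ j, t j < 1)
    (hφ : 0 < meanFieldFn lam Θ β t) :
    ∀ᶠ N : ℕ in atTop, meanFieldFn lam Θ β t / 4 * N ≤ logPartitionFn (hsbmTensor (H N)) β := by
  set φ := meanFieldFn lam Θ β t
  -- The density error then costs at most half of `φ`, and the rounding of block sizes in the
  -- entropy at most a quarter, leaving `φ / 4`. Tolerances `1 / (m + 1)` require only countably
  -- many almost sure events.
  obtain ⟨m, hm⟩ := exists_nat_gt (2 * (β * (K : ℝ) ^ p) / φ)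
  set ε : ℝ := 1 / ((m : ℝ) + 1)
  have hε : 0 < ε := by positivity
  have hεφ : β * (K : ℝ) ^ p * ε ≤ φ / 2 := by
    rw [div_lt_iff₀ hφ] at hm
    simp only [ε]
    rw [mul_one_div, div_le_iff₀ (by positivity)]
    nlinarith
  filter_upwards [eventually_all.2 fun j => hH j m, eventually_gt_atTop 0,
    tendsto_natCast_atTop_atTop.eventually_ge_atTop (4 * K / φ)] with N hN hNpos hNK
  have hN' : (0 : ℝ) < N := by exact_mod_cast hNpos
  have hNp : (0 : ℝ) < (N : ℝ) ^ (p - 1) := by positivity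
  have habs : ∀ j, |t j| < 1 := fun j => by rw [abs_of_nonneg (ht0 j)]; exact ht1 j
  have hgibbs := le_logPartitionFn (supp_hsbmTensor (H N)) β (t := fun v => t (b N v))
    fun v => habs _
  have henergy : N * ((∑ j : Fin p → Fin K, (Θ j : ℝ) * ∏ l, lam (j l) * t (j l)) -
      (K : ℝ) ^ p * ε) ≤ ∑ i, hsbmTensor (H N) i * ∏ l, t (b N (i l)) := by
    have e1 : ∑ i, hsbmTensor (H N) i * ∏ l, t (b N (i l)) =
        ∑ j : Fin p → Fin K, (∏ l, t (j l)) *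
          ((∑ i : Fin p → Fin N with b N ∘ i = j, adjTensor (H N) i) / (N : ℝ) ^ (p - 1)) := by
      rw [← Finset.sum_fiberwise Finset.univ (fun i : Fin p → Fin N => b N ∘ i)]
      refine Finset.sum_congr rfl fun j _ => ?_
      rw [Finset.sum_div, Finset.mul_sum]
      refine Finset.sum_congr rfl fun i hi => ?_
      rw [← (Finset.mem_filter.1 hi).2, hsbmTensor, mul_comm]
      rfl
    have e2 : ∀ j : Fin p → Fin K, N * ((Θ j : ℝ) * ∏ l, lam (j l) * t (j l)) - N * ε ≤
        (∏ l, t (j l)) *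
          ((∑ i : Fin p → Fin N with b N ∘ i = j, adjTensor (H N) i) / (N : ℝ) ^ (p - 1)) :=
      fun j => by
      have h2 : N * ((Θ j : ℝ) * ∏ l, lam (j l) - ε) ≤
          (∑ i : Fin p → Fin N with b N ∘ i = j, adjTensor (H N) i) / (N : ℝ) ^ (p - 1) := by
        rw [le_div_iff₀ hNp, mul_comm]
        exact hN j
      -- Since `t` is nonnegative, lower bounds on the edge counts are enough.
      have ht : 0 ≤ ∏ l, t (j l) := Finset.prod_nonneg fun l _ => ht0 _
      have ht' : ∏ l, t (j l) ≤ 1 := Finset.prod_le_one (fun l _ => ht0 _) fun l _ => (ht1 _).le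
      have h3 := mul_le_mul_of_nonneg_left h2 ht
      have h4 : (∏ l, t (j l)) * (N * ε) ≤ N * ε := mul_le_of_le_one_left (by positivity) ht'
      rw [Finset.prod_mul_distrib]
      linarith
    rw [e1]
    refine le_trans (le_of_eq ?_) (Finset.sum_le_sum fun j _ => e2 j)
    rw [Finset.sum_sub_distrib, ← Finset.mul_sum]
    simp [Finset.card_univ, Fintype.card_pi]
    ring
  have hent : ∑ v, binEntropyI (t (b N v)) ≤ N * (∑ j, lam j * binEntropyI (t j)) + K := by
    rw [← Finset.sum_fiberwise Finset.univ (b N)]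
    have : ∀ j, ∑ v with b N v = j, binEntropyI (t (b N v)) ≤
        N * (lam j * binEntropyI (t j)) + 1 := fun j => by
      have e1 := binEntropyI_nonneg (habs j).le
      have e2 := binEntropyI_le_one (habs j).le
      have e3 := (abs_le.1 (abs_card_block_sub_le h0 h1 (hb N) j)).2
      have e4 : ∑ v with b N v = j, binEntropyI (t (b N v)) =
          ((Finset.univ.filter fun v => b N v = j).card : ℝ) * binEntropyI (t j) := by
        rw [← nsmul_eq_mul, ← Finset.sum_const]
        exact Finset.sum_congr rfl fun v hv => by rw [(Finset.mem_filter.1 hv).2]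
      rw [e4]
      nlinarith
    refine (Finset.sum_le_sum fun j _ => this j).trans (le_of_eq ?_)
    rw [Finset.sum_add_distrib, ← Finset.mul_sum]
    simp
  have hφeq : φ = β * (∑ j : Fin p → Fin K, (Θ j : ℝ) * ∏ l, lam (j l) * t (j l)) -
    ∑ j, lam j * binEntropyI (t j) := rfl
  have e5 := mul_le_mul_of_nonneg_left henergy hβ
  have e6 := mul_le_mul_of_nonneg_left hεφ hN'.le
  have e7 : (K : ℝ) ≤ φ / 4 * N := by
    rw [div_le_iff₀ hφ] at hNK
    linarith
  have e8 : N * φ = N * (β * (∑ j : Fin p → Fin K, (Θ j : ℝ) * ∏ l, lam (j l) * t (j l))) -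
    N * ∑ j, lam j * binEntropyI (t j) := by rw [hφeq, mul_sub]
  rw [mul_sub, mul_sub] at e5
  linarith

lemma exists_ae_isSqrtConsistentAt (hp : 2 ≤ p) (h0 : ∀ j, 0 ≤ lam j) (h1 : ∑ j, lam j = 1)
    (hΘ : ∀ (σ : Equiv.Perm (Fin p)) (j : Fin p → Fin K), Θ (j ∘ σ) = Θ j)
    {Ω : Type*} [MeasurableSpace Ω] {μ : Measure Ω}
    {G : ∀ N : ℕ, Ω → UniformHypergraph p N} (hG : ∀ N, HasLaw (G N) (hsbmLaw lam Θ N) μ) :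
    ∃ M : ℝ → ℝ → ℝ, ∀ᵐ ω ∂μ, ∀ β : ℝ, hsbmThreshold lam Θ < (β : EReal) →
      IsSqrtConsistentAt (fun N => hsbmTensor (G N ω)) (fun N => mple (hsbmTensor (G N ω)))
        β (M β) := by
  -- The almost sure event concerns edge densities only, so one null set serves all `β`.
  choose b hb using fun (N : ℕ) (v : Fin N) => exists_mem_block (lam := lam) h1 v
  have hdens : ∀ᵐ ω ∂μ, ∀ (j : Fin p → Fin K) (m : ℕ), ∀ᶠ N : ℕ in atTop,
      (N : ℝ) ^ (p - 1) * (N * ((Θ j : ℝ) * ∏ l, lam (j l) - 1 / ((m : ℝ) + 1))) ≤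
        ∑ i : Fin p → Fin N with b N ∘ i = j, adjTensor (G N ω) i :=
    ae_all_iff.2 fun j => ae_all_iff.2 fun m =>
      ae_eventually_sum_adjTensor hp h0 h1 hΘ hG hb j (by positivity)
  -- The constant is chosen before the realization. The hypotheses stand inside the existential so
  -- that `M` is a total function, with the default 0 where they fail.
  have hM : ∀ β δ : ℝ, ∃ M : ℝ, hsbmThreshold lam Θ < (β : EReal) → 0 < δ → 0 < M ∧
      ∃ (t : Fin K → ℝ) (N₀ : ℕ), (∀ j, 0 ≤ t j) ∧ (∀ j, t j < 1) ∧ 0 < meanFieldFn lam Θ β t ∧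
        ∀ N ≥ N₀, ∀ J : Tensor p N, IsMeanFieldTensor J →
          meanFieldFn lam Θ β t / 4 * N ≤ logPartitionFn J β →
          1 - δ < isingProb J β {x | WithinDist (mple J x) β (M / √(N : ℝ))} := by
    intro β δ
    by_cases hβ : hsbmThreshold lam Θ < (β : EReal)
    · by_cases hδ : 0 < δ
      · obtain ⟨t, ht0, ht1, hφ⟩ := exists_meanFieldFn_pos (by omega) h0 hβ
        obtain ⟨M, hM, N₀, h⟩ := exists_isingProb_withinDist_mple (p := p) (by omega)
          (pos_of_hsbmThreshold_lt (by omega) h0 hβ)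
          (show 0 < meanFieldFn lam Θ β t / 4 by positivity) hδ
        exact ⟨M, fun _ _ => ⟨hM, t, N₀, ht0, ht1, hφ, h⟩⟩
      · exact ⟨0, fun _ h => absurd h hδ⟩
    · exact ⟨0, fun h => absurd h hβ⟩
  choose M hM using hM
  refine ⟨M, ?_⟩
  filter_upwards [hdens] with ω hω β hβ δ hδ
  obtain ⟨hpos, t, N₀, ht0, ht1, hφ, h⟩ := hM β δ hβ hδ
  refine ⟨hpos, ?_⟩
  filter_upwards [eventually_le_logPartitionFn h0 h1 hb (fun N => G N ω) hω
    (pos_of_hsbmThreshold_lt (by omega) h0 hβ).le ht0 ht1 hφ, eventually_ge_atTop N₀] with N hN hN₀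
  exact h N hN₀ _ (isMeanFieldTensor_hsbmTensor _) hN

end Above
theorem theorem3p4 {p K : ℕ} (hp : 2 ≤ p)
    (lam : Fin K → ℝ) (hlam_nonneg : ∀ j, 0 ≤ lam j) (hlam_sum : ∑ j, lam j = 1)
    (Θ : (Fin p → Fin K) → unitInterval)
    (hΘ : ∀ (σ : Equiv.Perm (Fin p)) (j : Fin p → Fin K), Θ (j ∘ σ) = Θ j)
    {Ω : Type*} [MeasurableSpace Ω] (μ : Measure Ω) [IsProbabilityMeasure μ]
    (G : ∀ N : ℕ, Ω → UniformHypergraph p N)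
    (hG : ∀ N, HasLaw (G N) (hsbmLaw lam Θ N) μ) :
    -- above the threshold, the MPL estimate is `√N`-consistent for almost every realization
    (∃ M : ℝ → ℝ → ℝ, ∀ᵐ ω ∂μ, ∀ β : ℝ, hsbmThreshold lam Θ < (β : EReal) →
      IsSqrtConsistentAt (fun N => hsbmTensor (G N ω)) (fun N => mple (hsbmTensor (G N ω)))
        β (M β)) ∧
    -- below the threshold, the expected log-partition function is bounded
    (∀ β : ℝ, 0 ≤ β → (β : EReal) < hsbmThreshold lam Θ →
      (fun N : ℕ => ∫ H, logPartitionFn (hsbmTensor H) β ∂(hsbmLaw lam Θ N))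
        =O[atTop] (fun _ => (1 : ℝ))) ∧
    -- for almost every realization, no estimators are consistent at two values below it
    (∀ᵐ ω ∂μ, ∀ β₁ β₂ : ℝ, 0 ≤ β₁ → β₁ < β₂ → (β₂ : EReal) < hsbmThreshold lam Θ →
      ¬ ∃ est : ∀ N, Spins N → EReal,
        IsConsistentAt (fun N => hsbmTensor (G N ω)) est β₁ ∧
        IsConsistentAt (fun N => hsbmTensor (G N ω)) est β₂) ∧
    -- the same for estimators under the joint law of the hypergraph and the spins
    (∀ β₁ β₂ : ℝ, 0 ≤ β₁ → β₁ < β₂ → (β₂ : EReal) < hsbmThreshold lam Θ →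
      ¬ ∃ est : ∀ N, UniformHypergraph p N → Spins N → EReal,
        IsJointlyConsistentAt lam Θ est β₁ ∧ IsJointlyConsistentAt lam Θ est β₂) := by
  exact ⟨exists_ae_isSqrtConsistentAt hp hlam_nonneg hlam_sum hΘ hG,
    fun β hβ hβ' => isBigO_integral_logPartitionFn hp hlam_nonneg hlam_sum hΘ hβ hβ',
    ae_not_isConsistentAt hp hlam_nonneg hlam_sum hΘ hG,
    fun β₁ β₂ h1 h12 h2 ⟨est, hc1, hc2⟩ =>
      not_isJointlyConsistentAt hp hlam_nonneg hlam_sum hΘ h1 h12 h2 est hc1 hc2⟩
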